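/- Let $d\in\{2,3\}$, let $\Omega\subset\mathbb R^d$ be a non-empty open set with $\operatorname{int}\overline\Omega=\Omega$ (for example a polygonal or Lipschitz polyhedral domain), let $\Gamma_D\subset\partial\Omega$, let $\partial\Omega\setminus\Gamma_D$ have positive surface measure, and let $r\ge 2$. Consider problems consisting of the following data, where all constants $k_0,c_\eta,\kappa,c_\delta>0$, $C_\eta,C_{\rm int},C_\chi,C_h$ and $0<b<1$ are the same for all problems considered. *Parameters.* $k\ge k_0$, $\varepsilon\in\mathbb R$ with $|\varepsilon|\le k^2$, $\eta\in\mathbb C$ with $c_\eta k\le|\eta|\le C_\eta k$. *Finite elements.* A finite conforming simplicial mesh of $\overline\Omega$ with elements $\tau$ of diameter $h_\tau$ that each contain a ball of radius $h_\tau/\kappa$, with $h=\max_\tau h_\tau$, and such that $\Gamma_D$ is a union of $(d-1)$-dimensional faces of the mesh. $\mathcal V^h$ is the space of continuous functions on $\overline\Omega$ that are polynomials of total degree at most $r-1$ on each element and vanish on $\Gamma_D$. It has a nodal basis $\phi_1,\dots,\phi_n$ with nodes $x_1,\dots,x_n\in\overline\Omega$, $\phi_p(x_q)=\delta_{pq}$,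 and the nodal interpolant $\Pi^hv=\sum_pv(x_p)\phi_p$ satisfies the standard estimate $$\|v-\Pi^hv\|_{L^2(\tau)}+h_\tau|v-\Pi^hv|_{H^1(\tau)}\le C_{\rm int}h_\tau^r|v|_{H^r(\tau)}$$ for every element $\tau$ and every continuous $v$ on $\overline\Omega$ that vanishes on $\Gamma_D$ and is smooth on $\tau$. *Decomposition.* Non-empty open sets $\Omega_1,\dots,\Omega_N$ with union $\Omega$, $\operatorname{int}\overline{\Omega_\ell}=\Omega_\ell$, each $\overline{\Omega_\ell}$ a union of elements and $\partial\Omega_\ell\setminus\Gamma_D\ne\emptyset$. There are $\delta_\ell>0$ such that, with $\Omega_{\ell,\mu}$ the set of points of $\Omega_\ell$ at distance at most $\mu$ from $\partial\Omega_\ell\setminus\partial\Omega$, we have $\Omega_{\ell,b\delta_\ell}\subset\Omega_\ell\cap\bigcup_{\ell'\ne\ell}\Omega_{\ell'}\subset\Omega_{\ell,\delta_\ell}$. There are continuous functions $\chi_\ell:\overline\Omega\to[0,1]$, affine on each element, zero outside $\overline{\Omega_\ell}$, with $\sum_\ell\chi_\ell=1$ and $|\nabla\chi_\ell|\le C_\chi/\delta_\ell$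 in the interior of each element. Put $\delta=\min_\ell\delta_\ell$ and $\Lambda=\max_\ell\#\{\ell':\overline{\Omega_\ell}\cap\overline{\Omega_{\ell'}}\ne\emptyset\}$. Assume $$kh\le C_h,\qquad k\delta\ge c_\delta .$$ *Matrices.* $(A_\varepsilon)_{pq}=\int_\Omega\nabla\phi_p\cdot\nabla\phi_q-(k^2+i\varepsilon)\int_\Omega\phi_p\phi_q-i\eta\int_{\partial\Omega\setminus\Gamma_D}\phi_p\phi_q$; $A_{\varepsilon,\ell}$ is defined by the same formula with $\Omega_\ell$ in place of $\Omega$, for the nodes $p,q$ on $\overline{\Omega_\ell}$; $(R_\ell\mathbf V)_p=\chi_\ell(x_p)V_p$ for the nodes $p$ on $\overline{\Omega_\ell}$; and $B_\varepsilon^{-1}=\sum_\ell R_\ell^\top A_{\varepsilon,\ell}^{-1}R_\ell$. Further $(D_k)_{pq}=\int_\Omega\nabla\phi_p\cdot\nabla\phi_q+k^2\int_\Omega\phi_p\phi_q$, and $D_{k,\ell}$ is defined likewise with $\Omega_\ell$ in place of $\Omega$, for the nodes on $\overline{\Omega_\ell}$; $\langle\mathbf V,\mathbf W\rangle_D=\mathbf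 W^*D\mathbf V$ and $\|\mathbf V\|_D=\langle\mathbf V,\mathbf V\rangle_D^{1/2}$. Then there is a constant $C>0$, depending only on $d,\Omega,\Gamma_D,r$ and the constants listed above (and so not on $k,\varepsilon,\eta$, the mesh, the nodal basis, the decomposition, $N$, $\delta$, $\Lambda$ or $\sigma$), such that the following holds. Consider any family of such problems, each with a number $\sigma>0$ such that $$\|(A_{\varepsilon,\ell}^{-1}R_\ell A_\varepsilon-R_\ell)\mathbf V\|_{D_{k,\ell}}\le\sigma\,\|\mathbf V|_{\overline{\Omega_\ell}}\|_{D_{k,\ell}}\qquad\text{for all }\mathbf V\in\mathbb C^n,\ \ell=1,\dots,N,$$ where $\mathbf V|_{\overline{\Omega_\ell}}$ is the restriction of $\mathbf V$ to the nodes on $\overline{\Omega_\ell}$. (i) For every problem of the family, $\|B_\varepsilon^{-1}A_\varepsilon\mathbf V\|_{D_k}\le C\Lambda(1+\sigma)\|\mathbf V\|_{D_k}$ for all $\mathbf V\in\mathbb C^n$; that is, $\|B_\varepsilon^{-1}A_\varepsilon\|_{D_k}\le C\Lambda(1+\sigma)$. (ii) If $k\delta\to\infty$ as $k\to\infty$ in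 the family, then for all problems of the family with $k$ sufficiently large there is $R\in\mathbb R$ with $|R|\le C\,\frac{\Lambda}{k\delta}(1+\sigma)$ and $$\min_{0\ne\mathbf V\in\mathbb C^n}\frac{|\langle\mathbf V,B_\varepsilon^{-1}A_\varepsilon\mathbf V\rangle_{D_k}|}{\|\mathbf V\|_{D_k}^2}\ \ge\ \Big(\frac1\Lambda-\sqrt2\,\sigma\Lambda\Big)+R .$$ -/

import Mathlib

open Filter Topology MeasureTheory
open scoped ContDiff

noncomputable section

namespace Schwarz

/-- Euclidean space of dimension `d`. -/
abbrev E (d : ℕ) := EuclideanSpace ℝ (Fin d)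

/-- On the set `τ`, the function `v` is a polynomial of total degree at most `m`. -/
def IsPolyOn {d : ℕ} (m : ℕ) (v : E d → ℝ) (τ : Set (E d)) : Prop :=
  ∃ p : MvPolynomial (Fin d) ℝ, p.totalDegree ≤ m ∧
    ∀ x ∈ τ, v x = MvPolynomial.eval (fun i => x i) p

/-- The `(d-1)`-dimensional surface measure (normalised to agree with Lebesgue measure on
hyperplanes). -/
def surface (d : ℕ) : Measure (E d) := Measure.euclideanHausdorffMeasure (d - 1)

/-- The `L²`-norm of `|f|` over `τ`. -/
def l2Norm {d : ℕ} {F : Type*} [NormedAddCommGroup F] (τ : Set (E d)) (f : E d → F) : ℝ :=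
  √(∫ x in τ, ‖f x‖ ^ 2)

/-- The data of one discretised Helmholtz problem together with one overlapping decomposition.
Functions are total functions on `ℝᵈ`, but only their values on the closed domain are used. -/
structure Discretisation (d : ℕ) where
  /-- wavenumber -/
  k : ℝ
  /-- absorption -/
  ε : ℝ
  /-- impedance parameter -/
  η : ℂ
  /-- the conforming simplicial mesh, with all faces of its elements -/
  mesh : Geometry.SimplicialComplex ℝ (E d)
  /-- number of nodes -/
  n : ℕ
  /-- the nodes -/
  node : Fin n → E d
  /-- the nodal basis functions -/
  φ : Fin n → E d → ℝ
  /-- number of subdomains -/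
  N : ℕ
  /-- the subdomains -/
  sub : Fin N → Set (E d)
  /-- the overlap parameters of the subdomains -/
  δℓ : Fin N → ℝ
  /-- the partition of unity -/
  χ : Fin N → E d → ℝ

namespace Discretisation

variable {d : ℕ} (P : Discretisation d)

/-- Vertex sets of the elements (the `d`-simplices) of the mesh. -/
def elements : Set (Finset (E d)) := {s | s ∈ P.mesh.faces ∧ s.card = d + 1}

/-- The closed simplex with vertex set `s`. -/
def cell (s : Finset (E d)) : Set (E d) := convexHull ℝ (s : Set (E d))

/-- The mesh diameter. -/
def h : ℝ := sSup ((fun s => Metric.diam (cell s)) '' P.elements)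

/-- The smallest overlap parameter. -/
def δ : ℝ := ⨅ ℓ, P.δℓ ℓ

open Classical in
/-- The largest number of subdomains whose closures meet the closure of a given one. -/
def Λ : ℕ := Finset.univ.sup fun ℓ : Fin P.N =>
  (Finset.univ.filter fun ℓ' : Fin P.N =>
    (closure (P.sub ℓ) ∩ closure (P.sub ℓ')).Nonempty).card

/-- Membership in the finite-element space: continuous functions on the closed domain that are
polynomials of total degree at most `r - 1` on every element and vanish on the Dirichlet
boundary. -/
def IsFE (Ω ΓD : Set (E d)) (r : ℕ) (v : E d → ℝ) : Prop :=
  ContinuousOn v (closure Ω) ∧ (∀ s ∈ P.elements, IsPolyOn (r - 1) v (cell s)) ∧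
    ∀ x ∈ ΓD, v x = 0

/-- The nodal interpolation operator. -/
def interp (v : E d → ℝ) : E d → ℝ := fun x => ∑ p, v (P.node p) * P.φ p x

/-- The part of a subdomain that is not overlapped by any other subdomain. -/
def core (ℓ : Fin P.N) : Set (E d) := P.sub ℓ \ ⋃ ℓ' ≠ ℓ, P.sub ℓ'

/-- The points of a subdomain whose distance from its interior boundary is at most `μ`. -/
def nearBoundary (Ω : Set (E d)) (ℓ : Fin P.N) (μ : ℝ) : Set (E d) :=
  {x ∈ P.sub ℓ | Metric.infEDist x (frontier (P.sub ℓ) \ frontier Ω) ≤ ENNReal.ofReal μ}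

/-! ### Matrices -/

/-- Stiffness matrix over the open set `U`. -/
def stiffness (U : Set (E d)) : Matrix (Fin P.n) (Fin P.n) ℝ := fun p q =>
  ∫ x in U, inner ℝ (gradient (P.φ p) x) (gradient (P.φ q) x)

/-- Domain mass matrix over the open set `U`. -/
def mass (U : Set (E d)) : Matrix (Fin P.n) (Fin P.n) ℝ := fun p q =>
  ∫ x in U, P.φ p x * P.φ q x

/-- Boundary mass matrix over the non-Dirichlet part of the boundary of `U`. -/
def boundaryMass (ΓD U : Set (E d)) : Matrix (Fin P.n) (Fin P.n) ℝ := fun p q =>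
  ∫ x in frontier U \ ΓD, P.φ p x * P.φ q x ∂(surface d)

/-- Matrix of the Helmholtz impedance form on `U` in all basis functions,
`S - (k² + iε) M - iη N`. -/
def helmholtz (ΓD U : Set (E d)) : Matrix (Fin P.n) (Fin P.n) ℂ :=
  (P.stiffness U).map (fun t => (t : ℂ))
    - ((P.k : ℂ) ^ 2 + Complex.I * (P.ε : ℂ)) • (P.mass U).map (fun t => (t : ℂ))
    - (Complex.I * P.η) • (P.boundaryMass ΓD U).map (fun t => (t : ℂ))

/-- Matrix of the Helmholtz energy inner product on `U` in all basis functions, `S + k² M`. -/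
def energy (U : Set (E d)) : Matrix (Fin P.n) (Fin P.n) ℂ :=
  (P.stiffness U).map (fun t => (t : ℂ)) + ((P.k : ℂ) ^ 2) • (P.mass U).map (fun t => (t : ℂ))

/-- Indices of the nodes on the closure of the subdomain `ℓ`. -/
abbrev LocalNode (ℓ : Fin P.N) : Type := {p : Fin P.n // P.node p ∈ closure (P.sub ℓ)}

instance (ℓ : Fin P.N) : Fintype (P.LocalNode ℓ) := Fintype.ofFinite _

/-- The global system matrix `A_ε`. -/
def A (Ω ΓD : Set (E d)) : Matrix (Fin P.n) (Fin P.n) ℂ := P.helmholtz ΓD Ω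

/-- The local system matrix `A_{ε,ℓ}`. -/
def Aloc (ΓD : Set (E d)) (ℓ : Fin P.N) : Matrix (P.LocalNode ℓ) (P.LocalNode ℓ) ℂ :=
  (P.helmholtz ΓD (P.sub ℓ)).submatrix Subtype.val Subtype.val

/-- The global energy matrix `D_k`. -/
def D (Ω : Set (E d)) : Matrix (Fin P.n) (Fin P.n) ℂ := P.energy Ω

/-- The energy matrix `D_{k,ℓ}` of the subdomain `ℓ`, on the nodes of that subdomain. -/
def Dloc (ℓ : Fin P.N) : Matrix (P.LocalNode ℓ) (P.LocalNode ℓ) ℂ :=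
  (P.energy (P.sub ℓ)).submatrix Subtype.val Subtype.val

/-- The weighted restriction matrix `R_ℓ`, `(R_ℓ V)_p = χ_ℓ(x_p) V_p`. -/
def R (ℓ : Fin P.N) : Matrix (P.LocalNode ℓ) (Fin P.n) ℂ := fun p q =>
  if p.1 = q then (P.χ ℓ (P.node q) : ℂ) else 0

/-- The one-level additive Schwarz preconditioner `B_ε⁻¹ = ∑ R_ℓᵀ A_{ε,ℓ}⁻¹ R_ℓ`.
The matrix inverse is zero for a singular matrix. -/
def Binv (ΓD : Set (E d)) : Matrix (Fin P.n) (Fin P.n) ℂ :=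
  ∑ ℓ, (P.R ℓ).transpose * (P.Aloc ΓD ℓ)⁻¹ * P.R ℓ

end Discretisation

/-- The inner product `⟨V, W⟩_D = W^* D V`. -/
def ip {I : Type*} [Fintype I] (D : Matrix I I ℂ) (V W : I → ℂ) : ℂ :=
  star W ⬝ᵥ D.mulVec V

/-- The norm `‖V‖_D = ⟨V, V⟩_D^{1/2}`. -/
def nrm {I : Type*} [Fintype I] (D : Matrix I I ℂ) (V : I → ℂ) : ℝ := √(ip D V V).re

/-- The constants hidden in the assumptions on a family of problems. -/
structure Constants where
  /-- lower bound for the wavenumber -/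
  k₀ : ℝ
  /-- lower and upper bounds for `|η| / k` -/
  cη : ℝ
  Cη : ℝ
  /-- shape regularity of the meshes -/
  κ : ℝ
  /-- interpolation constant of the nodal bases -/
  Cint : ℝ
  /-- overlap constant -/
  b : ℝ
  /-- bound for the gradients of the partition of unity -/
  Cχ : ℝ
  /-- upper bound for `k h` -/
  Ch : ℝ
  /-- lower bound for `k δ` -/
  cδ : ℝ
  k₀_pos : 0 < k₀
  cη_pos : 0 < cη
  κ_pos : 0 < κ
  b_pos : 0 < b
  b_lt_one : b < 1
  cδ_pos : 0 < cδ

/-- The standing assumptions on a discretised Helmholtz problem on `Ω` with Dirichlet boundary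
`ΓD` and finite elements of degree `r - 1`, with hidden constants `c`. -/
structure Discretisation.Admissible {d : ℕ} (P : Discretisation d) (Ω ΓD : Set (E d)) (r : ℕ)
    (c : Constants) : Prop where
  -- the parameters
  k_ge : c.k₀ ≤ P.k
  ε_le : |P.ε| ≤ P.k ^ 2
  η_ge : c.cη * P.k ≤ ‖P.η‖
  η_le : ‖P.η‖ ≤ c.Cη * P.k
  -- the mesh: a finite, pure, shape-regular triangulation of the closed domain that resolves the
  -- Dirichlet boundary
  finite_mesh : P.mesh.faces.Finite
  pure : ∀ s ∈ P.mesh.faces, ∃ t ∈ P.elements, s ⊆ t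
  space_eq : P.mesh.space = closure Ω
  shape_regular : ∀ s ∈ P.elements, ∃ x,
    Metric.closedBall x (Metric.diam (cell s) / c.κ) ⊆ cell s
  dirichlet : ∃ F ⊆ {s | s ∈ P.mesh.faces ∧ s.card = d}, ΓD = ⋃ s ∈ F, cell s
  -- the nodal basis of the finite-element space
  node_mem : ∀ p, P.node p ∈ closure Ω
  φ_fe : ∀ p, P.IsFE Ω ΓD r (P.φ p)
  φ_node : ∀ p q, P.φ p (P.node q) = if p = q then 1 else 0
  φ_span : ∀ v, P.IsFE Ω ΓD r v → ∀ x ∈ closure Ω, v x = P.interp v x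
  -- the nodal basis has the approximation order of the finite-element space: on each element, the
  -- error is of order `h_τ^r |v|_{H^r(τ)}`; here `g` is a smooth representative of `v` on `τ`
  interp_error : ∀ s ∈ P.elements, ∀ v g : E d → ℝ, ContinuousOn v (closure Ω) →
    (∀ x ∈ ΓD, v x = 0) → ContDiff ℝ ∞ g → (∀ x ∈ cell s, v x = g x) →
    l2Norm (cell s) (v - P.interp v)
        + Metric.diam (cell s) * l2Norm (cell s) (gradient (v - P.interp v))
      ≤ c.Cint * Metric.diam (cell s) ^ r * l2Norm (cell s) (iteratedFDeriv ℝ r g)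
  -- the subdomains: open, non-empty unions of elements that cover the domain
  sub_open : ∀ ℓ, IsOpen (P.sub ℓ)
  sub_nonempty : ∀ ℓ, (P.sub ℓ).Nonempty
  sub_regular : ∀ ℓ, interior (closure (P.sub ℓ)) = P.sub ℓ
  sub_elements : ∀ ℓ, ∃ T ⊆ P.elements, closure (P.sub ℓ) = ⋃ s ∈ T, cell s
  cover : ⋃ ℓ, P.sub ℓ = Ω
  sub_impedance : ∀ ℓ, (frontier (P.sub ℓ) \ ΓD).Nonempty
  -- the overlap
  δℓ_pos : ∀ ℓ, 0 < P.δℓ ℓ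
  overlap_lower : ∀ ℓ, P.nearBoundary Ω ℓ (c.b * P.δℓ ℓ) ⊆ P.sub ℓ \ P.core ℓ
  overlap_upper : ∀ ℓ, P.sub ℓ \ P.core ℓ ⊆ P.nearBoundary Ω ℓ (P.δℓ ℓ)
  -- the partition of unity: continuous and piecewise linear
  χ_cont : ∀ ℓ, ContinuousOn (P.χ ℓ) (closure Ω)
  χ_linear : ∀ ℓ, ∀ s ∈ P.elements, IsPolyOn 1 (P.χ ℓ) (cell s)
  χ_mem : ∀ ℓ, ∀ x ∈ closure Ω, P.χ ℓ x ∈ Set.Icc (0 : ℝ) 1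
  χ_supp : ∀ ℓ, ∀ x ∈ closure Ω, P.χ ℓ x ≠ 0 → x ∈ closure (P.sub ℓ)
  χ_sum : ∀ x ∈ closure Ω, ∑ ℓ, P.χ ℓ x = 1
  χ_grad : ∀ ℓ, ∀ s ∈ P.elements, ∀ x ∈ interior (cell s),
    ‖gradient (P.χ ℓ) x‖ ≤ c.Cχ / P.δℓ ℓ
  -- resolution of the wavelength by the mesh, and of the overlap by the wavelength
  kh_le : P.k * P.h ≤ c.Ch
  kδ_ge : c.cδ ≤ P.k * P.δ

/-- The bound `‖A_{ε,ℓ}⁻¹ R_ℓ A_ε - R_ℓ‖ ≤ σ`. The matrix maps nodal vectors on the closed domain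
to nodal vectors on the closed subdomain `ℓ`; the energy norm over that subdomain is used both for
the image and for the argument (restricted to the nodes of the subdomain). -/
def Discretisation.LocalBound {d : ℕ} (P : Discretisation d) (Ω ΓD : Set (E d)) (ℓ : Fin P.N)
    (σ : ℝ) : Prop :=
  ∀ V : Fin P.n → ℂ,
    nrm (P.Dloc ℓ) (((P.Aloc ΓD ℓ)⁻¹ * P.R ℓ * P.A Ω ΓD - P.R ℓ).mulVec V)
      ≤ σ * nrm (P.Dloc ℓ) (fun p => V p.1)

end Schwarz

end

noncomputable section

namespace Schwarz

/-! The energy inner product is an `L²` product of jets `(∇v, k v)`, and it splits into a sum over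
the elements and over real and imaginary parts. Write `Q_ℓ` for multiplication of nodal values by
`χ_ℓ`, and `E_ℓ` for `A_{ε,ℓ}⁻¹ R_ℓ A_ε - R_ℓ` followed by extension by zero. Then `B_ε⁻¹ A_ε = ∑
Q_ℓ (Q_ℓ + E_ℓ)` (`Binv_mul_A_mulVec`), and `E_ℓ` is bounded by `σ` on each subdomain.

The analytic core is `exists_interp_mul_error`: on every element `Q_ℓ` acts on jets as pointwise
multiplication by `χ_ℓ`, up to a relative error `θ` of order `1/(kδ)`. The commutator is the
product-rule term `w ∇χ_ℓ` minus the jet of the interpolation error of `χ_ℓ w`. Since `χ_ℓ` is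
affine and `w` has degree at most `r - 1`, the `r`-th derivative of `χ_ℓ w` involves only `∇χ_ℓ` and
`D^{r-1} w`. The inverse inequality (`exists_inverse_inequality`) then absorbs `h^{r-1}`, so both
terms are of size `|∇χ_ℓ| ‖w‖`, which is at most a multiple of `‖k w‖ / (kδ)`.

The rest is Hilbert space geometry. At most `Λ` subdomains contain a given element, which gives the
upper bound (`schwarz_norm_le`). For the lower bound (`schwarz_inner_ge`), the main term is `∑ ‖χ_ℓ
jet‖²`, which is at least `‖jet‖² / Λ` because `∑ χ_ℓ = 1`; the defects cost `σΛ`, and the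
commutators cost terms proportional to `θ`. -/

/-! ### Polynomial functions on Euclidean space -/

/-- The function on Euclidean space defined by a polynomial. -/
def polyFun {d : ℕ} (p : MvPolynomial (Fin d) ℝ) : E d → ℝ :=
  fun x => MvPolynomial.eval (fun i => x i) p

/-- Smooth functions all of whose derivatives of order larger than `m` vanish. -/
def DegLE {d : ℕ} (m : ℕ) (f : E d → ℝ) : Prop :=
  ContDiff ℝ ∞ f ∧ ∀ j, m < j → ∀ x, iteratedFDeriv ℝ j f x = 0

lemma DegLE.mono {d m m' : ℕ} {f : E d → ℝ} (h : DegLE m f) (hm : m ≤ m') : DegLE m' f :=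
  ⟨h.1, fun j hj x => h.2 j (by omega) x⟩

lemma degLE_const {d : ℕ} (a : ℝ) : DegLE (d := d) 0 (fun _ => a) := by
  refine ⟨contDiff_const, fun j hj x => ?_⟩
  rw [iteratedFDeriv_const_of_ne (by omega)]
  rfl

lemma degLE_coord {d : ℕ} (i : Fin d) : DegLE (d := d) 1 (fun x => x i) := by
  have h : (fun x : E d => x i) = (EuclideanSpace.proj i : E d →L[ℝ] ℝ) := rfl
  rw [h]
  refine ⟨ContinuousLinearMap.contDiff _, fun j hj x => ?_⟩
  obtain ⟨j, rfl⟩ : ∃ l, j = l + 1 := ⟨j - 1, by omega⟩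
  rw [← norm_eq_zero, ← norm_iteratedFDeriv_fderiv]
  have : fderiv ℝ (EuclideanSpace.proj i : E d →L[ℝ] ℝ)
      = fun _ => (EuclideanSpace.proj i : E d →L[ℝ] ℝ) := by
    ext1 y
    exact ContinuousLinearMap.fderiv _
  rw [this, iteratedFDeriv_const_of_ne (by omega)]
  simp

/-- In the Leibniz sum of order `j > a + b`, each term differentiates `f` more than `a` times or `g`
more than `b` times. -/
lemma DegLE.mul {d a b : ℕ} {f g : E d → ℝ} (hf : DegLE a f) (hg : DegLE b g) :
    DegLE (a + b) (fun x => f x * g x) := by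
  refine ⟨hf.1.mul hg.1, fun j hj x => ?_⟩
  rw [← norm_le_zero_iff]
  refine (norm_iteratedFDeriv_mul_le hf.1 hg.1 x (n := j) (by exact_mod_cast le_top)).trans
    (Finset.sum_nonpos fun i _ => ?_)
  by_cases hi : a < i
  · simp [hf.2 i hi x]
  · simp [hg.2 (j - i) (by omega) x]

lemma DegLE.add {d m : ℕ} {f g : E d → ℝ} (hf : DegLE m f) (hg : DegLE m g) :
    DegLE m (fun x => f x + g x) := by
  refine ⟨hf.1.add hg.1, fun j hj x => ?_⟩
  have := iteratedFDeriv_add_apply (𝕜 := ℝ) (i := j) (x := x) (f := f) (g := g)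
    (hf.1.contDiffAt.of_le (by exact_mod_cast le_top))
    (hg.1.contDiffAt.of_le (by exact_mod_cast le_top))
  have h2 : (fun x => f x + g x) = f + g := rfl
  rw [h2, this, hf.2 j hj x, hg.2 j hj x, add_zero]

lemma DegLE.sum {d m : ℕ} {α : Type*} (s : Finset α) {f : α → E d → ℝ}
    (hf : ∀ i ∈ s, DegLE m (f i)) : DegLE m (fun x => ∑ i ∈ s, f i x) := by
  classical
  induction s using Finset.induction_on with
  | empty => simpa using (degLE_const (d := d) 0).mono (Nat.zero_le m)
  | insert a s ha ih =>
    simp only [Finset.sum_insert ha]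
    exact (hf a (by simp)).add (ih fun i hi => hf i (by simp [hi]))

lemma DegLE.pow {d a : ℕ} {f : E d → ℝ} (hf : DegLE a f) (n : ℕ) :
    DegLE (n * a) (fun x => f x ^ n) := by
  induction n with
  | zero => simpa using degLE_const (d := d) 1
  | succ n ih =>
    simp only [pow_succ, Nat.succ_mul]
    exact ih.mul hf

lemma DegLE.prod {d : ℕ} {α : Type*} (s : Finset α) {f : α → E d → ℝ} {m : α → ℕ}
    (hf : ∀ i ∈ s, DegLE (m i) (f i)) :
    DegLE (∑ i ∈ s, m i) (fun x => ∏ i ∈ s, f i x) := by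
  classical
  induction s using Finset.induction_on with
  | empty => simpa using degLE_const (d := d) 1
  | insert a s ha ih =>
    simp only [Finset.prod_insert ha, Finset.sum_insert ha]
    exact (hf a (by simp)).mul (ih fun i hi => hf i (by simp [hi]))

lemma degLE_polyFun {d m : ℕ} {p : MvPolynomial (Fin d) ℝ} (hp : p.totalDegree ≤ m) :
    DegLE m (polyFun p) := by
  have h : polyFun p = fun x : E d => ∑ t ∈ p.support, p.coeff t * ∏ i, x i ^ t i := by
    ext x
    simp only [polyFun, MvPolynomial.eval_eq']
  rw [h]
  refine DegLE.sum _ fun t ht => ?_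
  have h1 : DegLE (∑ i, t i * 1) (fun x : E d => ∏ i, x i ^ t i) :=
    DegLE.prod _ fun i _ => (degLE_coord i).pow (t i)
  refine ((degLE_const (p.coeff t)).mul h1).mono ?_
  refine le_trans ?_ ((MvPolynomial.le_totalDegree ht).trans hp)
  simp [Finsupp.sum_fintype]

lemma contDiff_polyFun {d : ℕ} (p : MvPolynomial (Fin d) ℝ) : ContDiff ℝ ∞ (polyFun p) :=
  (degLE_polyFun le_rfl).1

/-- Transports polynomials between a ball of arbitrary centre and radius and the unit ball;
substituting polynomials of degree at most 1 for the variables does not raise the degree. -/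
lemma polyFun_comp_affine {d : ℕ} (p : MvPolynomial (Fin d) ℝ) (a : E d) (ρ : ℝ) :
    ∃ q : MvPolynomial (Fin d) ℝ, q.totalDegree ≤ p.totalDegree ∧
      ∀ x, polyFun q x = polyFun p (a + ρ • x) := by
  classical
  let y : Fin d → MvPolynomial (Fin d) ℝ := fun i =>
    MvPolynomial.C (a i) + MvPolynomial.C ρ * MvPolynomial.X i
  have hy : ∀ i, (y i).totalDegree ≤ 1 := by
    intro i
    refine (MvPolynomial.totalDegree_add _ _).trans (max_le ?_ ?_)
    · simp
    · refine (MvPolynomial.totalDegree_mul _ _).trans ?_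
      simp
  refine ⟨∑ t ∈ p.support, MvPolynomial.C (p.coeff t) * ∏ i, y i ^ t i, ?_, fun x => ?_⟩
  · refine MvPolynomial.totalDegree_finsetSum_le fun t ht => ?_
    refine (MvPolynomial.totalDegree_mul _ _).trans ?_
    rw [MvPolynomial.totalDegree_C, zero_add]
    refine (MvPolynomial.totalDegree_finsetProd _ _).trans ?_
    refine le_trans (Finset.sum_le_sum (g := fun i => t i) fun i _ => ?_) ?_
    · refine (MvPolynomial.totalDegree_pow _ _).trans ?_
      simpa using Nat.mul_le_mul_left (t i) (hy i)
    · refine le_trans ?_ (MvPolynomial.le_totalDegree ht)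
      simp [Finsupp.sum_fintype]
  · simp only [polyFun, map_sum, map_mul, map_prod, map_pow, MvPolynomial.eval_C, y, map_add,
      MvPolynomial.eval_X]
    rw [MvPolynomial.eval_eq']
    simp

/-- A linear map that vanishes on the kernel of another one is bounded by it. -/
lemma exists_norm_le_of_ker_le {V G H : Type*} [AddCommGroup V] [Module ℝ V]
    [FiniteDimensional ℝ V] [NormedAddCommGroup G] [NormedSpace ℝ G] [NormedAddCommGroup H]
    [NormedSpace ℝ H] (N : V →ₗ[ℝ] H) (L : V →ₗ[ℝ] G)
    (hker : LinearMap.ker N ≤ LinearMap.ker L) :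
    ∃ C : ℝ, 0 ≤ C ∧ ∀ v, ‖L v‖ ≤ C * ‖N v‖ := by
  -- `L` factors through the range of `N`; the factor is bounded because that range is
  -- finite-dimensional.
  let T : LinearMap.range N →ₗ[ℝ] G :=
    ((LinearMap.ker N).liftQ L hker) ∘ₗ N.quotKerEquivRange.symm.toLinearMap
  let T' := LinearMap.toContinuousLinearMap T
  refine ⟨‖T'‖, T'.opNorm_nonneg, fun v => ?_⟩
  have h : L v = T' ⟨N v, LinearMap.mem_range_self N v⟩ := by
    have : N.quotKerEquivRange.symm ⟨N v, LinearMap.mem_range_self N v⟩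
        = (LinearMap.ker N).mkQ v := by
      rw [LinearEquiv.symm_apply_eq]
      ext
      simp
    simp [T', T, this]
  rw [h]
  simpa using T'.le_opNorm ⟨N v, LinearMap.mem_range_self N v⟩

/-! ### The `L²`-norm over a compact set -/

section l2

variable {d : ℕ} {F G : Type*} [NormedAddCommGroup F] [NormedAddCommGroup G] {K : Set (E d)}

lemma l2Norm_nonneg (K : Set (E d)) (f : E d → F) : 0 ≤ l2Norm K f := Real.sqrt_nonneg _

lemma sq_l2Norm (K : Set (E d)) (f : E d → F) : l2Norm K f ^ 2 = ∫ x in K, ‖f x‖ ^ 2 :=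
  Real.sq_sqrt (integral_nonneg fun _ => by positivity)

lemma memLp_of_continuous (hK : IsCompact K) {f : E d → F} (hf : Continuous f) :
    MemLp f 2 (volume.restrict K) := by
  obtain ⟨C, hC⟩ := hK.exists_bound_of_continuousOn hf.continuousOn
  have : IsFiniteMeasure (volume.restrict K) := ⟨by
    rw [Measure.restrict_apply_univ]; exact hK.measure_lt_top⟩
  exact MemLp.of_bound hf.aestronglyMeasurable C
    ((ae_restrict_iff' hK.measurableSet).2 (Eventually.of_forall hC))

lemma norm_toLp_eq_l2Norm {f : E d → F} (hf : MemLp f 2 (volume.restrict K)) :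
    ‖hf.toLp f‖ = l2Norm K f := by
  rw [Lp.norm_toLp, hf.eLpNorm_eq_integral_rpow_norm (by norm_num) (by norm_num),
    ENNReal.toReal_ofReal (by positivity), l2Norm, Real.sqrt_eq_rpow]
  norm_num

lemma l2Norm_congr {f : E d → F} {g : E d → G} (h : ∀ᵐ x ∂(volume.restrict K), ‖f x‖ = ‖g x‖) :
    l2Norm K f = l2Norm K g := by
  unfold l2Norm
  congr 1
  exact integral_congr_ae (h.mono fun x hx => by simp only [hx])

lemma l2Norm_mono {f : E d → F} {g : E d → G} (hg : MemLp g 2 (volume.restrict K))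
    (h : ∀ᵐ x ∂(volume.restrict K), ‖f x‖ ≤ ‖g x‖) : l2Norm K f ≤ l2Norm K g := by
  unfold l2Norm
  refine Real.sqrt_le_sqrt (integral_mono_of_nonneg (Eventually.of_forall fun _ => by positivity)
    hg.norm.integrable_sq (h.mono fun x hx => ?_))
  exact pow_le_pow_left₀ (norm_nonneg _) hx 2

lemma l2Norm_add_le {f g : E d → F} (hf : MemLp f 2 (volume.restrict K))
    (hg : MemLp g 2 (volume.restrict K)) : l2Norm K (f + g) ≤ l2Norm K f + l2Norm K g := by
  rw [← norm_toLp_eq_l2Norm hf, ← norm_toLp_eq_l2Norm hg, ← norm_toLp_eq_l2Norm (hf.add hg),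
    MemLp.toLp_add]
  exact norm_add_le _ _

lemma l2Norm_const_mul {a : ℝ} (ha : 0 ≤ a) (f : E d → ℝ) :
    l2Norm K (fun x => a * f x) = a * l2Norm K f := by
  unfold l2Norm
  simp only [norm_mul, mul_pow, integral_const_mul]
  rw [Real.sqrt_mul (by positivity), Real.sqrt_sq (norm_nonneg a), Real.norm_of_nonneg ha]

end l2

/-! ### The inverse inequality -/

lemma memLp_polyFun {d : ℕ} {K : Set (E d)} (hK : IsCompact K) (p : MvPolynomial (Fin d) ℝ) :
    MemLp (polyFun p) 2 (volume.restrict K) :=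
  memLp_of_continuous hK (contDiff_polyFun p).continuous

/-- Both sides are seminorms on a finite-dimensional space, so it suffices to compare kernels: a
polynomial with zero `L²`-norm vanishes on the open ball, and with it all its derivatives at the
centre. -/
lemma exists_norm_iteratedFDeriv_le_unitBall (d m : ℕ) :
    ∃ C : ℝ, 0 ≤ C ∧ ∀ p : MvPolynomial (Fin d) ℝ, p.totalDegree ≤ m →
      ‖iteratedFDeriv ℝ m (polyFun p) 0‖ ≤ C * l2Norm (Metric.closedBall 0 1) (polyFun p) := by
  have hB : IsCompact (Metric.closedBall (0 : E d) 1) := isCompact_closedBall _ _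
  let N : MvPolynomial.restrictTotalDegree (Fin d) ℝ m →ₗ[ℝ]
      Lp ℝ 2 ((volume : Measure (E d)).restrict (Metric.closedBall 0 1)) :=
    { toFun := fun p => (memLp_polyFun hB p.1).toLp
      map_add' := fun p q => by
        rw [← MemLp.toLp_add]
        congr 1
        ext x
        simp [polyFun]
      map_smul' := fun a p => by
        rw [RingHom.id_apply, ← MemLp.toLp_const_smul]
        congr 1
        ext x
        simp [polyFun] }
  let L : MvPolynomial.restrictTotalDegree (Fin d) ℝ m →ₗ[ℝ]
      ContinuousMultilinearMap ℝ (fun _ : Fin m => E d) ℝ :=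
    { toFun := fun p => iteratedFDeriv ℝ m (polyFun p.1) 0
      map_add' := fun p q => by
        rw [← iteratedFDeriv_add_apply]
        · congr 1
          ext x
          simp [polyFun]
        · exact (contDiff_polyFun _).contDiffAt.of_le (by exact_mod_cast le_top)
        · exact (contDiff_polyFun _).contDiffAt.of_le (by exact_mod_cast le_top)
      map_smul' := fun a p => by
        rw [RingHom.id_apply, ← iteratedFDeriv_const_smul_apply]
        · congr 1
          ext x
          simp [polyFun]
        · exact (contDiff_polyFun _).contDiffAt.of_le (by exact_mod_cast le_top) }
  obtain ⟨C, hC0, hC⟩ := exists_norm_le_of_ker_le N L (by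
    intro p hp
    rw [LinearMap.mem_ker] at hp ⊢
    have h1 : polyFun p.1 =ᵐ[volume.restrict (Metric.closedBall (0 : E d) 1)] 0 :=
      (memLp_polyFun hB p.1).toLp_eq_toLp_iff MemLp.zero |>.1 hp
    have h2 : Set.EqOn (polyFun p.1) 0 (Metric.ball 0 1) :=
      Measure.eqOn_open_of_ae_eq (μ := volume)
        (ae_restrict_of_ae_restrict_of_subset Metric.ball_subset_closedBall h1)
        Metric.isOpen_ball (contDiff_polyFun _).continuous.continuousOn continuousOn_const
    have h3 : polyFun p.1 =ᶠ[𝓝 0] (fun _ => (0 : ℝ)) :=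
      h2.eventuallyEq_of_mem (Metric.ball_mem_nhds _ one_pos)
    have h4 := (h3.iteratedFDeriv ℝ m).eq_of_nhds
    change iteratedFDeriv ℝ m (polyFun p.1) 0 = 0
    rw [h4]
    exact congrFun iteratedFDeriv_fun_zero 0)
  refine ⟨C, hC0, fun p hp => ?_⟩
  have := hC ⟨p, (MvPolynomial.mem_restrictTotalDegree _ _ _).2 hp⟩
  rwa [show N ⟨p, _⟩ = (memLp_polyFun hB p).toLp from rfl, norm_toLp_eq_l2Norm] at this

lemma iteratedFDeriv_comp_affine {d m : ℕ} {f : E d → ℝ} (hf : ContDiff ℝ ∞ f) (a : E d) (ρ : ℝ) :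
    iteratedFDeriv ℝ m (fun x => f (a + ρ • x)) 0 = ρ ^ m • iteratedFDeriv ℝ m f a := by
  have h1 : (fun x => f (a + ρ • x))
      = (fun z => f (a + z)) ∘ (ρ • ContinuousLinearMap.id ℝ (E d)) := by
    ext x; simp
  have h2 : ContDiff ℝ ∞ (fun z => f (a + z)) := hf.comp (contDiff_const.add contDiff_id)
  rw [h1, ContinuousLinearMap.iteratedFDeriv_comp_right _ h2 _ (by exact_mod_cast le_top),
    iteratedFDeriv_comp_add_left]
  ext v
  simp only [ContinuousMultilinearMap.compContinuousLinearMap_apply,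
    smul_apply]
  have := (iteratedFDeriv ℝ m f a).map_smul_univ (fun _ => ρ) v
  simpa using this

lemma setIntegral_comp_affine {d : ℕ} (f : E d → ℝ) (a : E d) {ρ : ℝ} (hρ : 0 < ρ) :
    ∫ x in Metric.closedBall (0 : E d) 1, f (a + ρ • x)
      = (ρ ^ d)⁻¹ * ∫ x in Metric.closedBall a ρ, f x := by
  have h := Measure.setIntegral_comp_smul_of_pos (volume : Measure (E d)) (fun z => f (a + z))
    (Metric.closedBall (0 : E d) 1) hρ
  rw [h, finrank_euclideanSpace_fin, smul_unitClosedBall_of_nonneg hρ.le, smul_eq_mul]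
  congr 1
  have h2 := (measurePreserving_add_left (volume : Measure (E d)) a).setIntegral_preimage_emb
    (measurableEmbedding_addLeft a) f (Metric.closedBall a ρ)
  rw [← h2]
  congr 2
  ext x
  simp [dist_eq_norm]

/-- The derivative of top order is constant, so a bound at the centre of an inscribed ball controls
it on the whole element. -/
lemma DegLE.iteratedFDeriv_eq {d m : ℕ} {f : E d → ℝ} (hf : DegLE m f) (x y : E d) :
    iteratedFDeriv ℝ m f x = iteratedFDeriv ℝ m f y := by
  refine is_const_of_fderiv_eq_zero (𝕜 := ℝ)
    (hf.1.differentiable_iteratedFDeriv (by exact_mod_cast ENat.natCast_lt_top m)) (fun z => ?_) x y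
  rw [← norm_eq_zero, norm_fderiv_iteratedFDeriv, hf.2 _ (Nat.lt_succ_self m), norm_zero]

/-- Inverse inequality for the derivative of highest order of a polynomial. -/
lemma exists_inverse_inequality (d m : ℕ) {κ : ℝ} (hκ : 0 < κ) :
    ∃ C : ℝ, 0 ≤ C ∧ ∀ (p : MvPolynomial (Fin d) ℝ) (K : Set (E d)) (x : E d) (h : ℝ),
      p.totalDegree ≤ m → IsCompact K → 0 < h → Metric.closedBall x (h / κ) ⊆ K →
      K ⊆ Metric.closedBall x h →
      h ^ m * l2Norm K (iteratedFDeriv ℝ m (polyFun p)) ≤ C * l2Norm K (polyFun p) := by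
  obtain ⟨C, hC0, hC⟩ := exists_norm_iteratedFDeriv_le_unitBall d m
  set vol₁ : ℝ := (volume (Metric.ball (0 : E d) 1)).toReal with hvol
  -- The inscribed ball of radius `h / κ` bounds the top derivative and the ball of radius `h`
  -- bounds the volume of `K`; the ratio `κ` of the radii enters with power `2m` from scaling the
  -- squared derivative and `d` from the volumes.
  refine ⟨√(C ^ 2 * κ ^ (2 * m + d) * vol₁), Real.sqrt_nonneg _, fun p K x h hp hK hh hB hKh => ?_⟩
  have hρ : 0 < h / κ := by positivity
  set ρ := h / κ with hρdef
  have hhρ : h = κ * ρ := by rw [hρdef]; field_simp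
  obtain ⟨q, hq, hqp⟩ := polyFun_comp_affine p x ρ
  set A : ℝ := ‖iteratedFDeriv ℝ m (polyFun p) x‖ with hA
  have h1 : (ρ ^ m * A) ^ 2 ≤ C ^ 2 * ((ρ ^ d)⁻¹ * l2Norm K (polyFun p) ^ 2) := by
    have e1 := hC q (hq.trans hp)
    rw [show polyFun q = fun y => polyFun p (x + ρ • y) from funext hqp,
      iteratedFDeriv_comp_affine (contDiff_polyFun p), norm_smul, Real.norm_of_nonneg
      (by positivity)] at e1
    have e2 : l2Norm (Metric.closedBall 0 1) (fun y => polyFun p (x + ρ • y)) ^ 2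
        = (ρ ^ d)⁻¹ * ∫ y in Metric.closedBall x ρ, ‖polyFun p y‖ ^ 2 := by
      rw [sq_l2Norm]
      exact setIntegral_comp_affine (fun y => ‖polyFun p y‖ ^ 2) x hρ
    have e3 : ∫ y in Metric.closedBall x ρ, ‖polyFun p y‖ ^ 2 ≤ l2Norm K (polyFun p) ^ 2 := by
      rw [sq_l2Norm]
      exact setIntegral_mono_set (memLp_polyFun hK p).norm.integrable_sq
        (Eventually.of_forall fun _ => by positivity) (Eventually.of_forall hB)
    calc (ρ ^ m * A) ^ 2 ≤ (C * l2Norm (Metric.closedBall 0 1)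
            (fun y => polyFun p (x + ρ • y))) ^ 2 := pow_le_pow_left₀ (by positivity) e1 2
      _ = C ^ 2 * ((ρ ^ d)⁻¹ * ∫ y in Metric.closedBall x ρ, ‖polyFun p y‖ ^ 2) := by
          rw [mul_pow, e2]
      _ ≤ _ := by gcongr
  have h2 : l2Norm K (iteratedFDeriv ℝ m (polyFun p)) ^ 2 ≤ h ^ d * vol₁ * A ^ 2 := by
    have e1 : ∀ y, ‖iteratedFDeriv ℝ m (polyFun p) y‖ ^ 2 = A ^ 2 := fun y => by
      rw [(degLE_polyFun hp).iteratedFDeriv_eq y x]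
    rw [sq_l2Norm]
    simp only [e1, setIntegral_const, smul_eq_mul]
    gcongr
    have e2 : (volume (Metric.closedBall x h)).toReal = h ^ d * vol₁ := by
      rw [Measure.addHaar_closedBall _ _ hh.le, ENNReal.toReal_mul, finrank_euclideanSpace_fin,
        ENNReal.toReal_ofReal (by positivity)]
    rw [← e2]
    exact ENNReal.toReal_mono (isCompact_closedBall x h).measure_lt_top.ne (measure_mono hKh)
  refine le_of_sq_le_sq ?_ (mul_nonneg (Real.sqrt_nonneg _) (l2Norm_nonneg _ _))
  have hvol0 : 0 ≤ vol₁ := ENNReal.toReal_nonneg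
  rw [mul_pow, mul_pow, Real.sq_sqrt (by positivity)]
  calc (h ^ m) ^ 2 * l2Norm K (iteratedFDeriv ℝ m (polyFun p)) ^ 2
      ≤ (h ^ m) ^ 2 * (h ^ d * vol₁ * A ^ 2) := by gcongr
    _ = κ ^ (2 * m + d) * vol₁ * ρ ^ d * (ρ ^ m * A) ^ 2 := by rw [hhρ]; ring
    _ ≤ κ ^ (2 * m + d) * vol₁ * ρ ^ d * (C ^ 2 * ((ρ ^ d)⁻¹ * l2Norm K (polyFun p) ^ 2)) := by
        gcongr
    _ = _ := by field_simp

/-! ### Gradients and jets -/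

section jet

variable {d : ℕ} {f g : E d → ℝ} {x : E d}

lemma gradient_congr (h : f =ᶠ[𝓝 x] g) : gradient f x = gradient g x := by
  simp only [gradient, h.fderiv_eq]

lemma norm_gradient (f : E d → ℝ) (x : E d) : ‖gradient f x‖ = ‖fderiv ℝ f x‖ := by
  simp [gradient]

lemma gradient_add (hf : DifferentiableAt ℝ f x) (hg : DifferentiableAt ℝ g x) :
    gradient (fun y => f y + g y) x = gradient f x + gradient g x := by
  simp only [gradient, fderiv_fun_add hf hg, map_add]

lemma gradient_const_mul (a : ℝ) (hf : DifferentiableAt ℝ f x) :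
    gradient (fun y => a * f y) x = a • gradient f x := by
  simp only [gradient, fderiv_const_mul hf, map_smul]

lemma gradient_mul (hf : DifferentiableAt ℝ f x) (hg : DifferentiableAt ℝ g x) :
    gradient (fun y => f y * g y) x = f x • gradient g x + g x • gradient f x := by
  simp only [gradient, fderiv_fun_mul hf hg, map_add, map_smul]

lemma continuous_gradient (hf : ContDiff ℝ ∞ f) : Continuous (gradient f) :=
  (LinearIsometryEquiv.continuous _).comp (hf.continuous_fderiv (by simp))

/-- The pair `(∇f, k f)`, whose `L²`-norm is the Helmholtz energy norm of `f`. -/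
def jet (k : ℝ) (f : E d → ℝ) (x : E d) : WithLp 2 (E d × ℝ) :=
  WithLp.toLp 2 (gradient f x, k * f x)

lemma continuous_jet (k : ℝ) (hf : ContDiff ℝ ∞ f) : Continuous (jet k f) :=
  (WithLp.prod_continuous_toLp 2 _ _).comp
    ((continuous_gradient hf).prodMk (continuous_const.mul hf.continuous))

lemma jet_congr (k : ℝ) (h : f =ᶠ[𝓝 x] g) : jet k f x = jet k g x := by
  simp only [jet, gradient_congr h, h.eq_of_nhds]

lemma jet_add (k : ℝ) (hf : DifferentiableAt ℝ f x) (hg : DifferentiableAt ℝ g x) :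
    jet k (fun y => f y + g y) x = jet k f x + jet k g x := by
  simp only [jet, gradient_add hf hg, mul_add, ← WithLp.toLp_add, Prod.mk_add_mk]

lemma jet_const_mul (k a : ℝ) (hf : DifferentiableAt ℝ f x) :
    jet k (fun y => a * f y) x = a • jet k f x := by
  simp only [jet, gradient_const_mul a hf, ← WithLp.toLp_smul, Prod.smul_mk, smul_eq_mul]
  congr 2
  ring

/-- The commutator contains `g` but no derivative of `g`. Measured against `k g`, it is smaller by a
factor `1/k`. -/
lemma jet_mul (k : ℝ) (hf : DifferentiableAt ℝ f x) (hg : DifferentiableAt ℝ g x) :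
    jet k (fun y => f y * g y) x
      = f x • jet k g x + WithLp.toLp 2 (g x • gradient f x, (0 : ℝ)) := by
  simp only [jet, gradient_mul hf hg, ← WithLp.toLp_smul, ← WithLp.toLp_add, Prod.smul_mk,
    Prod.mk_add_mk, smul_eq_mul]
  congr 2
  ring

lemma norm_toLp_prod_le (u : E d) (a : ℝ) :
    ‖(WithLp.toLp 2 (u, a) : WithLp 2 (E d × ℝ))‖ ≤ ‖u‖ + ‖a‖ := by
  rw [WithLp.prod_norm_eq_of_L2]
  refine Real.sqrt_le_iff.2 ⟨by positivity, ?_⟩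
  change ‖u‖ ^ 2 + ‖a‖ ^ 2 ≤ _
  nlinarith [norm_nonneg u, norm_nonneg a]

lemma norm_mul_le_norm_jet (k : ℝ) (f : E d → ℝ) (x : E d) : ‖k * f x‖ ≤ ‖jet k f x‖ := by
  rw [jet, WithLp.prod_norm_eq_of_L2]
  refine Real.le_sqrt_of_sq_le ?_
  change _ ≤ ‖gradient f x‖ ^ 2 + ‖k * f x‖ ^ 2
  nlinarith [sq_nonneg ‖gradient f x‖]

lemma inner_jet (k : ℝ) (f g : E d → ℝ) (x : E d) :
    inner ℝ (jet k f x) (jet k g x)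
      = inner ℝ (gradient f x) (gradient g x) + k ^ 2 * (f x * g x) := by
  simp only [jet, WithLp.prod_inner_apply]
  simp
  ring

end jet

namespace Discretisation

/-! ### Elements of the mesh -/

variable {d : ℕ} {P : Discretisation d} {Ω ΓD : Set (E d)} {r : ℕ} {c : Constants}
  {s : Finset (E d)}

lemma isCompact_cell (s : Finset (E d)) : IsCompact (cell s) :=
  s.finite_toSet.isCompact_convexHull ℝ

/-- A convex set has null frontier. Finite-element functions need not be differentiable on the
faces, so all statements on gradients are made at interior points. -/
lemma ae_mem_interior_cell (s : Finset (E d)) :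
    ∀ᵐ x ∂(volume.restrict (cell s)), x ∈ interior (cell s) := by
  have h := (convex_convexHull ℝ (s : Set (E d))).addHaar_frontier volume
  rw [ae_restrict_iff' (isCompact_cell s).measurableSet]
  have h2 : ∀ᵐ x ∂(volume : Measure (E d)), x ∉ frontier (cell s) := measure_eq_zero_iff_ae_notMem.1 h
  filter_upwards [h2] with x hx hxs
  by_contra hi
  exact hx ⟨subset_closure hxs, hi⟩

lemma diam_cell_pos (hd : 0 < d) (hs : s ∈ P.elements) : 0 < Metric.diam (cell s) := by
  have h1 : 1 < s.card := by rw [hs.2]; omega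
  obtain ⟨a, ha, b, hb, hab⟩ := Finset.one_lt_card.1 h1
  exact (dist_pos.2 hab).trans_le (Metric.dist_le_diam_of_mem (isCompact_cell s).isBounded
    (subset_convexHull ℝ _ ha) (subset_convexHull ℝ _ hb))

namespace Admissible

lemma exists_closedBall (hP : P.Admissible Ω ΓD r c) (hs : s ∈ P.elements) :
    ∃ x, Metric.closedBall x (Metric.diam (cell s) / c.κ) ⊆ cell s ∧
      cell s ⊆ Metric.closedBall x (Metric.diam (cell s)) := by
  obtain ⟨x, hx⟩ := hP.shape_regular s hs
  refine ⟨x, hx, fun y hy => ?_⟩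
  have hxs : x ∈ cell s :=
    hx (Metric.mem_closedBall_self (div_nonneg Metric.diam_nonneg c.κ_pos.le))
  exact Metric.dist_le_diam_of_mem (isCompact_cell s).isBounded hy hxs

/-- The inscribed ball gives the convex cell an interior, which is then dense in it. This lets
identities that hold almost everywhere pass to every point of the cell. -/
lemma closure_interior_cell (hP : P.Admissible Ω ΓD r c) (hd : 0 < d) (hs : s ∈ P.elements) :
    closure (interior (cell s)) = cell s := by
  obtain ⟨x, hx, -⟩ := hP.exists_closedBall hs
  have hpos : 0 < Metric.diam (cell s) / c.κ := div_pos (diam_cell_pos hd hs) c.κ_pos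
  have hne : (interior (cell s)).Nonempty := ⟨x, interior_mono hx
    (interior_mono Metric.ball_subset_closedBall (by
      rw [Metric.isOpen_ball.interior_eq]; exact Metric.mem_ball_self hpos))⟩
  have := (convex_convexHull ℝ (s : Set (E d))).closure_interior_eq_closure_of_nonempty_interior hne
  exact this.trans (isCompact_cell s).isClosed.closure_eq

lemma eq_zero_of_ae_cell (hP : P.Admissible Ω ΓD r c) (hd : 0 < d) (hs : s ∈ P.elements)
    {f : E d → ℝ} (hf : ContinuousOn f (cell s)) (h0 : f =ᵐ[volume.restrict (cell s)] 0) :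
    ∀ x ∈ cell s, f x = 0 := by
  have h1 : Set.EqOn f 0 (interior (cell s)) := Measure.eqOn_open_of_ae_eq (μ := volume)
    (ae_restrict_of_ae_restrict_of_subset interior_subset h0) isOpen_interior
    (hf.mono interior_subset) continuousOn_const
  have h2 : Set.EqOn f 0 (cell s) := h1.of_subset_closure hf continuousOn_const interior_subset
    (hP.closure_interior_cell hd hs).ge
  exact h2

lemma cell_subset (hP : P.Admissible Ω ΓD r c) (hs : s ∈ P.elements) : cell s ⊆ closure Ω := by
  rw [← hP.space_eq]
  exact P.mesh.convexHull_subset_space hs.1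

lemma closure_eq_iUnion (hP : P.Admissible Ω ΓD r c) :
    closure Ω = ⋃ s ∈ P.elements, cell s := by
  refine Set.Subset.antisymm ?_ (Set.iUnion₂_subset fun s hs => hP.cell_subset hs)
  rw [← hP.space_eq]
  intro x hx
  obtain ⟨s, hs, hxs⟩ := Geometry.SimplicialComplex.mem_space_iff.1 hx
  obtain ⟨t, ht, hst⟩ := hP.pure s hs
  exact Set.mem_iUnion₂.2 ⟨t, ht, convexHull_mono (by exact_mod_cast hst) hxs⟩

lemma finite_elements (hP : P.Admissible Ω ΓD r c) : P.elements.Finite :=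
  hP.finite_mesh.subset fun _ h => h.1

lemma diam_le_h (hP : P.Admissible Ω ΓD r c) (hs : s ∈ P.elements) :
    Metric.diam (cell s) ≤ P.h :=
  le_csSup (hP.finite_elements.image _).bddAbove ⟨s, hs, rfl⟩

lemma k_pos (hP : P.Admissible Ω ΓD r c) : 0 < P.k := c.k₀_pos.trans_le hP.k_ge

end Admissible

/-! ### Functions that are polynomial on an element -/

lemma eventuallyEq_of_mem_interior {f g : E d → ℝ} (h : ∀ x ∈ cell s, f x = g x) {x : E d}
    (hx : x ∈ interior (cell s)) : f =ᶠ[𝓝 x] g := by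
  filter_upwards [isOpen_interior.mem_nhds hx] with y hy using h y (interior_subset hy)

lemma _root_.Schwarz.IsPolyOn.exists_polyFun {m : ℕ} {f : E d → ℝ} {τ : Set (E d)}
    (h : IsPolyOn m f τ) : ∃ p : MvPolynomial (Fin d) ℝ, p.totalDegree ≤ m ∧
      ∀ x ∈ τ, f x = polyFun p x := h

lemma _root_.Schwarz.IsPolyOn.differentiableAt {m : ℕ} {f : E d → ℝ} (h : IsPolyOn m f (cell s))
    {x : E d} (hx : x ∈ interior (cell s)) : DifferentiableAt ℝ f x := by
  obtain ⟨p, -, hp⟩ := h.exists_polyFun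
  exact (eventuallyEq_of_mem_interior hp hx).differentiableAt_iff.2
    ((contDiff_polyFun p).differentiable (by simp) x)

lemma _root_.Schwarz.IsPolyOn.continuousOn {m : ℕ} {f : E d → ℝ} {τ : Set (E d)}
    (h : IsPolyOn m f τ) : ContinuousOn f τ := by
  obtain ⟨p, -, hp⟩ := h.exists_polyFun
  exact (contDiff_polyFun p).continuous.continuousOn.congr hp

lemma _root_.Schwarz.IsPolyOn.mul {a b : ℕ} {f g : E d → ℝ} {τ : Set (E d)}
    (hf : IsPolyOn a f τ) (hg : IsPolyOn b g τ) : IsPolyOn (a + b) (fun x => f x * g x) τ := by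
  obtain ⟨p, hp, hfp⟩ := hf
  obtain ⟨q, hq, hgq⟩ := hg
  refine ⟨p * q, (MvPolynomial.totalDegree_mul _ _).trans (by omega), fun x hx => ?_⟩
  simp only [hfp x hx, hgq x hx, map_mul]

lemma _root_.Schwarz.IsPolyOn.sub {a b : ℕ} {f g : E d → ℝ} {τ : Set (E d)}
    (hf : IsPolyOn a f τ) (hg : IsPolyOn b g τ) :
    IsPolyOn (max a b) (fun x => f x - g x) τ := by
  obtain ⟨p, hp, hfp⟩ := hf
  obtain ⟨q, hq, hgq⟩ := hg
  refine ⟨p - q, (MvPolynomial.totalDegree_sub _ _).trans (max_le_max hp hq), fun x hx => ?_⟩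
  simp only [hfp x hx, hgq x hx, map_sub]

lemma _root_.Schwarz.IsPolyOn.memLp {m : ℕ} {f : E d → ℝ} (h : IsPolyOn m f (cell s)) :
    MemLp f 2 (volume.restrict (cell s)) := by
  obtain ⟨p, -, hp⟩ := h.exists_polyFun
  refine (memLp_congr_ae ?_).2 (memLp_polyFun (isCompact_cell s) p)
  filter_upwards [ae_restrict_mem (isCompact_cell s).measurableSet] with x hx using hp x hx

lemma _root_.Schwarz.IsPolyOn.memLp_gradient {m : ℕ} {f : E d → ℝ} (h : IsPolyOn m f (cell s)) :
    MemLp (gradient f) 2 (volume.restrict (cell s)) := by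
  obtain ⟨p, -, hp⟩ := h.exists_polyFun
  refine (memLp_congr_ae ?_).2
    (memLp_of_continuous (isCompact_cell s) (continuous_gradient (contDiff_polyFun p)))
  filter_upwards [ae_mem_interior_cell s] with x hx
    using gradient_congr (eventuallyEq_of_mem_interior hp hx)

lemma _root_.Schwarz.IsPolyOn.memLp_smul_jet {a m : ℕ} {f g : E d → ℝ}
    (hf : IsPolyOn a f (cell s)) (h : IsPolyOn m g (cell s)) (k : ℝ) :
    MemLp (fun x => f x • jet k g x) 2 (volume.restrict (cell s)) := by
  obtain ⟨p, -, hp⟩ := hf.exists_polyFun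
  obtain ⟨q, -, hq⟩ := h.exists_polyFun
  refine (memLp_congr_ae ?_).2 (memLp_of_continuous (isCompact_cell s)
    ((contDiff_polyFun p).continuous.smul (continuous_jet k (contDiff_polyFun q))))
  filter_upwards [ae_mem_interior_cell s] with x hx
  rw [jet_congr k (eventuallyEq_of_mem_interior hq hx), hp x (interior_subset hx)]
  rfl

lemma _root_.Schwarz.IsPolyOn.memLp_jet {m : ℕ} {f : E d → ℝ} (h : IsPolyOn m f (cell s))
    (k : ℝ) : MemLp (jet k f) 2 (volume.restrict (cell s)) := by
  have h1 : IsPolyOn 0 (fun _ => (1 : ℝ)) (cell s) := ⟨1, by simp, by simp⟩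
  simpa using h1.memLp_smul_jet h k

/-! ### Finite-element functions -/

/-- The finite-element function with the given nodal values. -/
def fe (P : Discretisation d) (W : Fin P.n → ℝ) (x : E d) : ℝ := ∑ p, W p * P.φ p x

namespace Admissible

lemma isPolyOn_fe (hP : P.Admissible Ω ΓD r c) (hs : s ∈ P.elements) (W : Fin P.n → ℝ) :
    IsPolyOn (r - 1) (P.fe W) (cell s) := by
  choose p hp hφ using fun i => ((hP.φ_fe i).2.1 s hs)
  refine ⟨∑ i, MvPolynomial.C (W i) * p i, ?_, fun x hx => ?_⟩
  · refine MvPolynomial.totalDegree_finsetSum_le fun i _ => ?_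
    refine (MvPolynomial.totalDegree_mul _ _).trans ?_
    simpa using hp i
  · simp [fe, hφ _ x hx]

lemma continuousOn_fe (hP : P.Admissible Ω ΓD r c) (W : Fin P.n → ℝ) :
    ContinuousOn (P.fe W) (closure Ω) :=
  continuousOn_finsetSum _ fun i _ => continuousOn_const.mul (hP.φ_fe i).1

lemma fe_dirichlet (hP : P.Admissible Ω ΓD r c) (W : Fin P.n → ℝ) {x : E d} (hx : x ∈ ΓD) :
    P.fe W x = 0 :=
  Finset.sum_eq_zero fun i _ => by rw [(hP.φ_fe i).2.2 x hx, mul_zero]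

lemma fe_node (hP : P.Admissible Ω ΓD r c) (W : Fin P.n → ℝ) (q : Fin P.n) :
    P.fe W (P.node q) = W q := by
  simp [fe, hP.φ_node]

end Admissible

/-! ### Commutator of nodal multiplication by an affine function with the jet -/

/-- Only the Leibniz term with exactly one derivative on `f` survives: more derivatives annihilate
`f`, and with none on `f` all `m + 1` annihilate `g`. -/
lemma norm_iteratedFDeriv_affine_mul_le {f g : E d → ℝ} {m : ℕ} (hf : DegLE 1 f) (hg : DegLE m g)
    (x : E d) : ‖iteratedFDeriv ℝ (m + 1) (fun y => f y * g y) x‖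
      ≤ (m + 1) * (‖gradient f x‖ * ‖iteratedFDeriv ℝ m g x‖) := by
  refine (norm_iteratedFDeriv_mul_le hf.1 hg.1 x (n := m + 1) (by exact_mod_cast le_top)).trans ?_
  rw [Finset.sum_eq_single 1]
  · rw [Nat.choose_one_right, norm_gradient, ← norm_iteratedFDeriv_one]
    simp [mul_assoc]
  · intro i _ hi
    rcases Nat.lt_or_ge 1 i with h | h
    · simp [hf.2 i h x]
    · have : i = 0 := by omega
      subst this
      simp [hg.2 (m + 1) (by omega) x]
  · intro h
    simp at h

/-- Multiplication by an affine function, followed by interpolation, acts on finite-element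
functions as multiplication by the affine function up to a term controlled by its gradient. -/
lemma exists_interp_mul_error (d : ℕ) (hd : 0 < d) (r : ℕ) (hr : 1 ≤ r) (c : Constants) :
    ∃ C : ℝ, 0 ≤ C ∧ ∀ (Ω ΓD : Set (E d)) (P : Discretisation d), P.Admissible Ω ΓD r c →
      ∀ s ∈ P.elements, ∀ (f : E d → ℝ) (G : ℝ), ContinuousOn f (closure Ω) →
      IsPolyOn 1 f (cell s) → 0 ≤ G → (∀ x ∈ interior (cell s), ‖gradient f x‖ ≤ G) →
      ∀ W : Fin P.n → ℝ,
      l2Norm (cell s) (fun x => jet P.k (P.fe fun p => f (P.node p) * W p) x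
          - f x • jet P.k (P.fe W) x)
        ≤ C * (G / P.k) * l2Norm (cell s) (jet P.k (P.fe W)) := by
  obtain ⟨m, rfl⟩ : ∃ m, r = m + 1 := ⟨r - 1, by omega⟩
  obtain ⟨Ci, hCi0, hCi⟩ := exists_inverse_inequality d m c.κ_pos
  -- The 1 comes from the product-rule term `w ∇f`, the rest from the interpolation error: `1 +
  -- |Ch|` bounds `1 + kh`, `m + 1` is the Leibniz factor and `Ci` the inverse inequality. Absolute
  -- values are taken because `Cint` and `Ch` carry no sign.
  refine ⟨1 + |c.Cint| * (1 + |c.Ch|) * (m + 1) * Ci, by positivity,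
    fun Ω ΓD P hP s hs f G hfc hf hG hfG W => ?_⟩
  have hk := hP.k_pos
  set K := cell s with hK
  set h := Metric.diam K with hh
  have hpos : 0 < h := diam_cell_pos hd hs
  have hkh : P.k * h ≤ |c.Ch| :=
    ((mul_le_mul_of_nonneg_left (hP.diam_le_h hs) hk.le).trans hP.kh_le).trans (le_abs_self _)
  set w := P.fe W with hw
  set v : E d → ℝ := fun x => f x * w x with hv
  have hinterp : P.interp v = P.fe fun p => f (P.node p) * W p := by
    ext x
    simp only [interp, hv, hw, hP.fe_node]
    rfl
  set e : E d → ℝ := v - P.interp v with he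
  have hwp : IsPolyOn m w K := hP.isPolyOn_fe hs W
  have hvp := hf.mul hwp
  have hep : IsPolyOn _ e K := hvp.sub (hP.isPolyOn_fe hs _) |> fun t => by
    rw [he, hinterp]; exact t
  obtain ⟨pf, hpf, hfpf⟩ := hf.exists_polyFun
  obtain ⟨pw, hpw, hwpw⟩ := hwp.exists_polyFun
  have herr := hP.interp_error s hs v (fun x => polyFun pf x * polyFun pw x)
    (hfc.mul (hP.continuousOn_fe W)) (fun x hx => by simp [hv, hw, hP.fe_dirichlet W hx])
    ((contDiff_polyFun pf).mul (contDiff_polyFun pw))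
    (fun x hx => by simp only [hv, hfpf x hx, hwpw x hx])
  have hl2w : l2Norm K (polyFun pw) = l2Norm K w := l2Norm_congr (by
    filter_upwards [ae_restrict_mem (isCompact_cell s).measurableSet] with x hx
    rw [hwpw x hx])
  have hcontD : Continuous (iteratedFDeriv ℝ m (polyFun pw)) :=
    (contDiff_polyFun pw).continuous_iteratedFDeriv (by exact_mod_cast le_top)
  have hDr : l2Norm K (iteratedFDeriv ℝ (m + 1) fun x => polyFun pf x * polyFun pw x)
      ≤ (m + 1) * G * l2Norm K (iteratedFDeriv ℝ m (polyFun pw)) := by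
    have e1 : l2Norm K (iteratedFDeriv ℝ m (polyFun pw))
        = l2Norm K (fun x => ‖iteratedFDeriv ℝ m (polyFun pw) x‖) :=
      l2Norm_congr (Eventually.of_forall fun x => by simp)
    rw [e1, ← l2Norm_const_mul (by positivity)]
    refine l2Norm_mono (memLp_of_continuous (isCompact_cell s)
      (continuous_const.mul hcontD.norm)) ?_
    filter_upwards [ae_mem_interior_cell s] with x hx
    refine (norm_iteratedFDeriv_affine_mul_le (degLE_polyFun hpf) (degLE_polyFun hpw) x).trans ?_
    rw [Real.norm_of_nonneg (by positivity), mul_assoc]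
    have := hfG x hx
    rw [gradient_congr (eventuallyEq_of_mem_interior hfpf hx)] at this
    gcongr
  obtain ⟨x₀, hx₀, hx₀'⟩ := hP.exists_closedBall hs
  have hinv := hCi pw K x₀ h hpw (isCompact_cell s) hpos hx₀ hx₀'
  rw [hl2w] at hinv
  -- Of the power `h^(m+1)` in the interpolation estimate, the inverse inequality consumes `h^m`;
  -- the remaining `h` cancels the weight of the gradient on the left.
  have hes : l2Norm K (gradient e) + P.k * l2Norm K e
      ≤ |c.Cint| * (1 + |c.Ch|) * (m + 1) * Ci * (G * l2Norm K w) := by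
    have a0 := l2Norm_nonneg K e
    have a1 := l2Norm_nonneg K (gradient e)
    have hD0 := l2Norm_nonneg K (iteratedFDeriv ℝ m (polyFun pw))
    have a2 : l2Norm K e + h * l2Norm K (gradient e)
        ≤ |c.Cint| * h * ((m + 1) * G * (Ci * l2Norm K w)) := by
      refine herr.trans ?_
      calc _ ≤ |c.Cint| * h ^ (m + 1)
            * ((m + 1) * G * l2Norm K (iteratedFDeriv ℝ m (polyFun pw))) := by
            gcongr
            · exact l2Norm_nonneg _ _
            · exact le_abs_self _
        _ = |c.Cint| * h
            * ((m + 1) * G * (h ^ m * l2Norm K (iteratedFDeriv ℝ m (polyFun pw)))) := by ring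
        _ ≤ _ := by gcongr
    have a3 : h * (l2Norm K (gradient e) + P.k * l2Norm K e)
        ≤ (1 + P.k * h) * (l2Norm K e + h * l2Norm K (gradient e)) := by
      have : 0 ≤ P.k * h * (h * l2Norm K (gradient e)) := by positivity
      nlinarith
    have hw0 := l2Norm_nonneg K w
    have a4 : (1 + P.k * h) * (l2Norm K e + h * l2Norm K (gradient e))
        ≤ (1 + |c.Ch|) * (|c.Cint| * h * ((m + 1) * G * (Ci * l2Norm K w))) := by
      gcongr
    refine le_of_mul_le_mul_left ((a3.trans a4).trans_eq ?_) hpos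
    ring
  -- The factor `1/k` is gained here: `w` itself is controlled by `k⁻¹` times its jet.
  have hkw : l2Norm K w ≤ l2Norm K (jet P.k w) / P.k := by
    rw [le_div_iff₀' hk, ← l2Norm_const_mul hk.le]
    exact l2Norm_mono (hwp.memLp_jet P.k)
      (Eventually.of_forall fun x => norm_mul_le_norm_jet P.k w x)
  have hmain : l2Norm K (fun x => jet P.k (P.fe fun p => f (P.node p) * W p) x
      - f x • jet P.k w x) ≤ G * l2Norm K w + (l2Norm K (gradient e) + P.k * l2Norm K e) := by
    have m1 : MemLp (fun x => G * ‖w x‖) 2 (volume.restrict K) := hwp.memLp.norm.const_mul G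
    have m2 : MemLp (fun x => ‖gradient e x‖) 2 (volume.restrict K) := hep.memLp_gradient.norm
    have m3 : MemLp (fun x => P.k * ‖e x‖) 2 (volume.restrict K) := hep.memLp.norm.const_mul P.k
    have e1 : G * l2Norm K w = l2Norm K (fun x => G * ‖w x‖) := by
      rw [l2Norm_const_mul hG]
      congr 1
      exact l2Norm_congr (Eventually.of_forall fun x => by simp)
    have e2 : l2Norm K (gradient e) = l2Norm K (fun x => ‖gradient e x‖) :=
      l2Norm_congr (Eventually.of_forall fun x => by simp)
    have e3 : P.k * l2Norm K e = l2Norm K (fun x => P.k * ‖e x‖) := by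
      rw [l2Norm_const_mul hk.le]
      congr 1
      exact l2Norm_congr (Eventually.of_forall fun x => by simp)
    rw [e1, e2, e3]
    refine (l2Norm_mono (m1.add (m2.add m3)) ?_).trans
      ((l2Norm_add_le m1 (m2.add m3)).trans (by gcongr; exact l2Norm_add_le m2 m3))
    filter_upwards [ae_mem_interior_cell s] with x hx
    -- Writing the interpolant as `v - e` leaves `(w ∇f, 0) - jet e` as the commutator.
    have hsplit : (P.fe fun p => f (P.node p) * W p) = fun y => v y + (-1) * e y := by
      ext y
      simp only [he, ← hinterp, Pi.sub_apply]
      ring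
    have hj : jet P.k (P.fe fun p => f (P.node p) * W p) x - f x • jet P.k w x
        = WithLp.toLp 2 (w x • gradient f x, (0 : ℝ)) - jet P.k e x := by
      rw [hsplit, jet_add P.k (hvp.differentiableAt hx)
        ((hep.differentiableAt hx).const_mul _), jet_const_mul _ _ (hep.differentiableAt hx),
        jet_mul P.k (hf.differentiableAt hx) (hwp.differentiableAt hx)]
      module
    rw [hj]
    have b1 := norm_toLp_prod_le (w x • gradient f x) (0 : ℝ)
    have b2 : ‖jet P.k e x‖ ≤ _ := norm_toLp_prod_le (gradient e x) (P.k * e x)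
    have b3 : ‖w x • gradient f x‖ ≤ G * ‖w x‖ := by
      rw [norm_smul, mul_comm]
      exact mul_le_mul_of_nonneg_right (hfG x hx) (norm_nonneg _)
    rw [norm_mul, Real.norm_of_nonneg hk.le] at b2
    rw [norm_zero, add_zero] at b1
    refine (norm_sub_le _ _).trans ((add_le_add (b1.trans b3) b2).trans ?_)
    exact le_abs_self _
  refine hmain.trans ?_
  calc G * l2Norm K w + (l2Norm K (gradient e) + P.k * l2Norm K e)
      ≤ G * l2Norm K w + |c.Cint| * (1 + |c.Ch|) * (m + 1) * Ci * (G * l2Norm K w) := by gcongr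
    _ = (1 + |c.Cint| * (1 + |c.Ch|) * (m + 1) * Ci) * (G * l2Norm K w) := by ring
    _ ≤ (1 + |c.Cint| * (1 + |c.Ch|) * (m + 1) * Ci) * (G * (l2Norm K (jet P.k w) / P.k)) := by
        gcongr
    _ = _ := by ring

end Discretisation

/-! ### Abstract additive Schwarz estimates -/

section abstract_estimates

variable {α L X : Type*} [AddCommGroup X] [Module ℝ X]
  {H : α → Type*} [∀ a, NormedAddCommGroup (H a)] [∀ a, InnerProductSpace ℝ (H a)]
  {j : ∀ a, X →ₗ[ℝ] H a} {Q Ev : L → X → X} {m : L → ∀ a, X → H a} {T : L → Finset α}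
  {θ σ Λ : ℝ}

/-- In the application `a` is an element with a choice of real or imaginary part, `j a` the jet, `Q
l` nodal and `m l a` pointwise multiplication by `χ_l`, `Ev l` the local defect, `T l` the pieces of
subdomain `l`, and `θ` the commutator bound. -/
lemma norm_schwarz_term_le (hm : ∀ l a V, ‖m l a V‖ ≤ ‖j a V‖)
    (hQ : ∀ l a V, a ∈ T l → ‖j a (Q l V) - m l a V‖ ≤ θ * ‖j a V‖)
    (l : L) (a : α) (ha : a ∈ T l) (V : X) : ‖j a (Q l V)‖ ≤ (1 + θ) * ‖j a V‖ := by
  have h1 := norm_add_le (j a (Q l V) - m l a V) (m l a V)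
  rw [sub_add_cancel] at h1
  linarith [hQ l a V ha, hm l a V]

/-- Cauchy–Schwarz over a whole subdomain: the defect is bounded only there and not element by
element. -/
lemma sum_mul_le_of_sum_sq_le {s : Finset α} {u w : α → ℝ} (hσ : 0 ≤ σ)
    (h : ∑ a ∈ s, w a ^ 2 ≤ σ ^ 2 * ∑ a ∈ s, u a ^ 2) :
    ∑ a ∈ s, u a * w a ≤ σ * ∑ a ∈ s, u a ^ 2 := by
  have hS0 : 0 ≤ ∑ a ∈ s, u a ^ 2 := Finset.sum_nonneg fun _ _ => by positivity
  refine (Real.sum_mul_le_sqrt_mul_sqrt _ _ _).trans ?_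
  calc _ ≤ √(∑ a ∈ s, u a ^ 2) * √(σ ^ 2 * ∑ a ∈ s, u a ^ 2) := by gcongr
    _ = σ * ∑ a ∈ s, u a ^ 2 := by
      rw [Real.sqrt_mul (sq_nonneg σ), Real.sqrt_sq hσ, mul_left_comm, Real.mul_self_sqrt hS0]

variable [Fintype α] [Fintype L] [∀ a l, Decidable (a ∈ T l)]

lemma sum_sum_le_of_card_le {f : α → ℝ} (hf : ∀ a, 0 ≤ f a)
    (hcard : ∀ a, ((Finset.univ.filter fun l => a ∈ T l).card : ℝ) ≤ Λ) :
    ∑ l, ∑ a ∈ T l, f a ≤ Λ * ∑ a, f a := by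
  have h : ∑ l, ∑ a ∈ T l, f a = ∑ a, ∑ l ∈ Finset.univ.filter fun l => a ∈ T l, f a := by
    rw [Finset.sum_comm' (t' := Finset.univ)
      (s' := fun a => Finset.univ.filter fun l => a ∈ T l)]
    intro x y
    simp
  rw [h, Finset.mul_sum]
  refine Finset.sum_le_sum fun a _ => ?_
  rw [Finset.sum_const, nsmul_eq_mul]
  exact mul_le_mul_of_nonneg_right (hcard a) (hf a)

/-- For the squared norms, one factor `Λ` comes from Cauchy–Schwarz over the subdomains that meet a
piece, the other from counting each piece at most `Λ` times. The outer and the inner `Q l`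
contribute `1 + θ` each. -/
lemma schwarz_norm_le (hθ : 0 ≤ θ) (hσ : 0 ≤ σ) (hΛ : 0 ≤ Λ)
    (hm : ∀ l a V, ‖m l a V‖ ≤ ‖j a V‖)
    (hQ : ∀ l a V, a ∈ T l → ‖j a (Q l V) - m l a V‖ ≤ θ * ‖j a V‖)
    (hQ0 : ∀ l a V, a ∉ T l → j a (Q l V) = 0)
    (hcard : ∀ a, ((Finset.univ.filter fun l => a ∈ T l).card : ℝ) ≤ Λ)
    (hE : ∀ l V, ∑ a ∈ T l, ‖j a (Ev l V)‖ ^ 2 ≤ σ ^ 2 * ∑ a ∈ T l, ‖j a V‖ ^ 2) (V : X) :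
    ∑ a, ‖j a (∑ l, Q l (Q l V + Ev l V))‖ ^ 2
      ≤ ((1 + θ) ^ 2 * (Λ * (1 + σ))) ^ 2 * ∑ a, ‖j a V‖ ^ 2 := by
  have hterm := norm_schwarz_term_le hm hQ
  have h1 : ∀ a, ‖j a (∑ l, Q l (Q l V + Ev l V))‖ ^ 2
      ≤ Λ * ∑ l ∈ Finset.univ.filter (fun l => a ∈ T l),
        ((1 + θ) * ‖j a (Q l V + Ev l V)‖) ^ 2 := by
    intro a
    rw [map_sum, ← Finset.sum_filter_add_sum_filter_not Finset.univ (fun l => a ∈ T l),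
      Finset.sum_eq_zero (s := Finset.univ.filter fun l => ¬ a ∈ T l)
      (fun l hl => hQ0 l a _ (Finset.mem_filter.1 hl).2), add_zero]
    calc _ ≤ (∑ l ∈ Finset.univ.filter (fun l => a ∈ T l),
            ‖j a (Q l (Q l V + Ev l V))‖) ^ 2 :=
          pow_le_pow_left₀ (norm_nonneg _) (norm_sum_le _ _) 2
      _ ≤ ((Finset.univ.filter fun l => a ∈ T l).card : ℝ)
            * ∑ l ∈ Finset.univ.filter (fun l => a ∈ T l),
              ‖j a (Q l (Q l V + Ev l V))‖ ^ 2 := sq_sum_le_card_mul_sum_sq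
      _ ≤ _ := by
          refine mul_le_mul (hcard a) (Finset.sum_le_sum fun l hl => ?_)
            (Finset.sum_nonneg fun _ _ => by positivity) hΛ
          exact pow_le_pow_left₀ (norm_nonneg _) (hterm l a (Finset.mem_filter.1 hl).2 _) 2
  have h2 : ∀ l, ∑ a ∈ T l, ‖j a (Q l V + Ev l V)‖ ^ 2
      ≤ ((1 + θ) * (1 + σ)) ^ 2 * ∑ a ∈ T l, ‖j a V‖ ^ 2 := by
    intro l
    set S := ∑ a ∈ T l, ‖j a V‖ ^ 2 with hS
    have hS0 : 0 ≤ S := Finset.sum_nonneg fun _ _ => by positivity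
    have b1 : ∀ a ∈ T l, ‖j a (Q l V + Ev l V)‖ ^ 2 ≤ (1 + θ) ^ 2 * ‖j a V‖ ^ 2
        + 2 * (1 + θ) * (‖j a V‖ * ‖j a (Ev l V)‖) + ‖j a (Ev l V)‖ ^ 2 := by
      intro a ha
      rw [map_add]
      have e1 := (norm_add_le (j a (Q l V)) (j a (Ev l V))).trans
        (add_le_add_left (hterm l a ha V) _)
      calc _ ≤ _ := pow_le_pow_left₀ (norm_nonneg _) e1 2
        _ = _ := by ring
    have b2 : ∑ a ∈ T l, ‖j a V‖ * ‖j a (Ev l V)‖ ≤ σ * S := sum_mul_le_of_sum_sq_le hσ (hE l V)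
    calc _ ≤ _ := Finset.sum_le_sum b1
      _ = (1 + θ) ^ 2 * S + 2 * (1 + θ) * ∑ a ∈ T l, ‖j a V‖ * ‖j a (Ev l V)‖
          + ∑ a ∈ T l, ‖j a (Ev l V)‖ ^ 2 := by
          rw [Finset.sum_add_distrib, Finset.sum_add_distrib, ← Finset.mul_sum, ← Finset.mul_sum]
      _ ≤ (1 + θ) ^ 2 * S + 2 * (1 + θ) * (σ * S) + σ ^ 2 * S := by
          gcongr
          exact hE l V
      _ = (1 + θ + σ) ^ 2 * S := by ring
      _ ≤ _ := by
          gcongr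
          nlinarith [mul_nonneg hθ hσ]
  calc _ ≤ ∑ a, Λ * ∑ l ∈ Finset.univ.filter (fun l => a ∈ T l),
        ((1 + θ) * ‖j a (Q l V + Ev l V)‖) ^ 2 := Finset.sum_le_sum fun a _ => h1 a
    _ = Λ * (1 + θ) ^ 2 * ∑ l, ∑ a ∈ T l, ‖j a (Q l V + Ev l V)‖ ^ 2 := by
        rw [← Finset.mul_sum, Finset.sum_comm' (t' := Finset.univ) (s' := T) (by simp), mul_assoc]
        simp only [mul_pow, Finset.mul_sum]
    _ ≤ Λ * (1 + θ) ^ 2 * ∑ l, ((1 + θ) * (1 + σ)) ^ 2 * ∑ a ∈ T l, ‖j a V‖ ^ 2 := by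
        gcongr with l
        exact h2 l
    _ = Λ * (1 + θ) ^ 2 * (((1 + θ) * (1 + σ)) ^ 2 * ∑ l, ∑ a ∈ T l, ‖j a V‖ ^ 2) := by
        rw [← Finset.mul_sum]
    _ ≤ Λ * (1 + θ) ^ 2 * (((1 + θ) * (1 + σ)) ^ 2 * (Λ * ∑ a, ‖j a V‖ ^ 2)) := by
        gcongr
        exact sum_sum_le_of_card_le (fun a => by positivity) hcard
    _ = _ := by ring

/-- The symmetry of `m` moves one multiplication to the left argument, so up to `θ` the term with `Q
l (Q l V)` is `‖m l a V‖²`, and these sum to at least `1/Λ` of the norm squared. The defect term is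
estimated by Cauchy–Schwarz and costs `(1 + θ) σ Λ`. -/
lemma schwarz_inner_ge (hθ : 0 ≤ θ) (hσ : 0 ≤ σ) (hΛ : 0 < Λ)
    (hm : ∀ l a V, ‖m l a V‖ ≤ ‖j a V‖)
    (hsymm : ∀ l a V W, inner ℝ (j a V) (m l a W) = inner ℝ (m l a V) (j a W))
    (hsum : ∀ a V, ‖j a V‖ ^ 2
      ≤ Λ * ∑ l ∈ Finset.univ.filter (fun l => a ∈ T l), ‖m l a V‖ ^ 2)
    (hQ : ∀ l a V, a ∈ T l → ‖j a (Q l V) - m l a V‖ ≤ θ * ‖j a V‖)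
    (hQ0 : ∀ l a V, a ∉ T l → j a (Q l V) = 0)
    (hcard : ∀ a, ((Finset.univ.filter fun l => a ∈ T l).card : ℝ) ≤ Λ)
    (hE : ∀ l V, ∑ a ∈ T l, ‖j a (Ev l V)‖ ^ 2 ≤ σ ^ 2 * ∑ a ∈ T l, ‖j a V‖ ^ 2)
    (hadd : ∀ l V W, Q l (V + W) = Q l V + Q l W) (V : X) :
    (1 / Λ - σ * Λ - Λ * θ * (2 + θ + σ)) * ∑ a, ‖j a V‖ ^ 2
      ≤ ∑ a, inner ℝ (j a V) (j a (∑ l, Q l (Q l V + Ev l V))) := by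
  have hterm := norm_schwarz_term_le hm hQ
  set S := ∑ a, ‖j a V‖ ^ 2 with hS
  have hsplit : ∑ a, inner ℝ (j a V) (j a (∑ l, Q l (Q l V + Ev l V)))
      = ∑ l, ∑ a ∈ T l, (inner ℝ (j a V) (j a (Q l (Q l V)))
        + inner ℝ (j a V) (j a (Q l (Ev l V)))) := by
    simp only [map_sum, inner_sum]
    rw [Finset.sum_comm]
    refine Finset.sum_congr rfl fun l _ => ?_
    rw [← Finset.sum_subset (Finset.subset_univ (T l))
      (fun a _ ha => by rw [hQ0 l a _ ha, inner_zero_right])]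
    refine Finset.sum_congr rfl fun a _ => ?_
    rw [hadd, map_add, inner_add_right]
  -- Replacing the outer `Q l` by `m` costs `θ (1 + θ)`, since it acts on `Q l V`; replacing the
  -- inner one costs `θ`.
  have h1 : ∀ l, ∀ a ∈ T l, ‖m l a V‖ ^ 2 - θ * (2 + θ) * ‖j a V‖ ^ 2
      ≤ inner ℝ (j a V) (j a (Q l (Q l V))) := by
    intro l a ha
    have e1 := abs_le.1 (abs_real_inner_le_norm (j a V) (j a (Q l (Q l V)) - m l a (Q l V)))
    have e2 := abs_le.1 (abs_real_inner_le_norm (m l a V) (j a (Q l V) - m l a V))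
    rw [inner_sub_right] at e1 e2
    rw [hsymm] at e1
    rw [real_inner_self_eq_norm_sq] at e2
    have e3 : ‖j a V‖ * ‖j a (Q l (Q l V)) - m l a (Q l V)‖
        ≤ ‖j a V‖ * (θ * ((1 + θ) * ‖j a V‖)) := by
      gcongr
      exact (hQ l a _ ha).trans (by gcongr; exact hterm l a ha V)
    have e4 : ‖m l a V‖ * ‖j a (Q l V) - m l a V‖ ≤ ‖j a V‖ * (θ * ‖j a V‖) :=
      mul_le_mul (hm l a V) (hQ l a V ha) (norm_nonneg _) (norm_nonneg _)
    nlinarith [e1.1, e2.1]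
  have h2 : ∀ l, -((1 + θ) * σ * ∑ a ∈ T l, ‖j a V‖ ^ 2)
      ≤ ∑ a ∈ T l, inner ℝ (j a V) (j a (Q l (Ev l V))) := by
    intro l
    set S' := ∑ a ∈ T l, ‖j a V‖ ^ 2 with hS'
    have b2 : ∑ a ∈ T l, ‖j a V‖ * ‖j a (Ev l V)‖ ≤ σ * S' := sum_mul_le_of_sum_sq_le hσ (hE l V)
    have b3 : ∑ a ∈ T l, -((1 + θ) * (‖j a V‖ * ‖j a (Ev l V)‖))
        ≤ ∑ a ∈ T l, inner ℝ (j a V) (j a (Q l (Ev l V))) := by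
      refine Finset.sum_le_sum fun a ha => ?_
      have e1 := (abs_le.1 (abs_real_inner_le_norm (j a V) (j a (Q l (Ev l V))))).1
      have e2 := mul_le_mul_of_nonneg_left (hterm l a ha (Ev l V)) (norm_nonneg (j a V))
      linarith
    rw [Finset.sum_neg_distrib, ← Finset.mul_sum] at b3
    have := mul_le_mul_of_nonneg_left b2 (by positivity : 0 ≤ 1 + θ)
    linarith
  have h3 : S / Λ ≤ ∑ l, ∑ a ∈ T l, ‖m l a V‖ ^ 2 := by
    rw [div_le_iff₀' hΛ, Finset.sum_comm' (t' := Finset.univ)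
      (s' := fun a => Finset.univ.filter fun l => a ∈ T l) (by simp), Finset.mul_sum]
    exact Finset.sum_le_sum fun a _ => hsum a V
  have h4 : ∑ l, ∑ a ∈ T l, ‖j a V‖ ^ 2 ≤ Λ * S :=
    sum_sum_le_of_card_le (fun a => by positivity) hcard
  rw [hsplit]
  have h5 : ∑ l, (∑ a ∈ T l, ‖m l a V‖ ^ 2 - (θ * (2 + θ) + (1 + θ) * σ)
      * ∑ a ∈ T l, ‖j a V‖ ^ 2) ≤ ∑ l, ∑ a ∈ T l, (inner ℝ (j a V) (j a (Q l (Q l V)))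
        + inner ℝ (j a V) (j a (Q l (Ev l V)))) := by
    refine Finset.sum_le_sum fun l _ => ?_
    rw [Finset.sum_add_distrib]
    have := Finset.sum_le_sum (h1 l)
    rw [Finset.sum_sub_distrib, ← Finset.mul_sum] at this
    linarith [h2 l]
  rw [Finset.sum_sub_distrib, ← Finset.mul_sum] at h5
  have h6 := mul_le_mul_of_nonneg_left h4
    (by positivity : 0 ≤ θ * (2 + θ) + (1 + θ) * σ)
  have h7 : (1 / Λ - σ * Λ - Λ * θ * (2 + θ + σ)) * S
      = S / Λ - (θ * (2 + θ) + (1 + θ) * σ) * (Λ * S) := by ring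
  linarith

end abstract_estimates

namespace Discretisation

variable {d : ℕ} {P : Discretisation d} {Ω ΓD : Set (E d)} {r : ℕ} {c : Constants}

/-! ### Decomposition of integrals over the mesh -/

/-- The intersection lies in the affine span of the common vertices; fewer than `d + 1` points span
a proper affine subspace, which is null. -/
lemma volume_cell_inter_cell {s t : Finset (E d)} (hs : s ∈ P.elements) (ht : t ∈ P.elements)
    (hst : s ≠ t) : volume (cell s ∩ cell t) = 0 := by
  classical
  have h1 : cell s ∩ cell t ⊆ affineSpan ℝ ((s ∩ t : Finset (E d)) : Set (E d)) := by
    refine (P.mesh.inter_subset_convexHull hs.1 ht.1).trans ?_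
    rw [← Finset.coe_inter]
    exact convexHull_subset_affineSpan _
  refine measure_mono_null h1 (Measure.addHaar_affineSubspace _ _ fun htop => ?_)
  have hind : AffineIndependent ℝ ((↑) : ((s ∩ t : Finset (E d)) : Set (E d)) → E d) :=
    (P.mesh.indep hs.1).mono (by exact_mod_cast Finset.inter_subset_left)
  have hcard := (hind.affineSpan_eq_top_iff_card_eq_finrank_add_one).1 (by
    rwa [Subtype.range_coe])
  rw [finrank_euclideanSpace_fin, ← hs.2] at hcard
  have hcard' : (s ∩ t).card = s.card := by simpa using hcard
  have h2 : s ⊆ t := Finset.inter_eq_left.1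
    (Finset.eq_of_subset_of_card_le Finset.inter_subset_left hcard'.ge)
  exact hst (Finset.eq_of_subset_of_card_le h2 (by rw [hs.2, ht.2]))

lemma restrict_biUnion_cell (T : Finset P.elements) :
    (volume : Measure (E d)).restrict (⋃ s ∈ T, cell s.1)
      = ∑ s ∈ T, volume.restrict (cell s.1) := by
  classical
  induction T using Finset.induction_on with
  | empty => simp
  | insert a T ha ih =>
    rw [Finset.set_biUnion_insert, Finset.sum_insert ha, ← ih]
    refine Measure.restrict_union₀ ?_ ?_
    · rw [AEDisjoint, Set.inter_iUnion₂]
      refine (measure_biUnion_null_iff (Finset.countable_toSet T)).2 fun t ht => ?_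
      exact volume_cell_inter_cell a.2 t.2 fun h => ha (Subtype.ext h ▸ ht)
    · exact (Finset.measurableSet_biUnion T
        fun t _ => (isCompact_cell t.1).measurableSet).nullMeasurableSet

/-- `U` and its closure differ by a null set: a point of the closure off all cell frontiers is
interior to a cell, hence to the closure, whose interior is `U`. -/
lemma restrict_eq_sum_cell {U : Set (E d)} (hU : interior (closure U) = U) {T : Finset P.elements}
    (hT : closure U = ⋃ s ∈ T, cell s.1) :
    (volume : Measure (E d)).restrict U = ∑ s ∈ T, volume.restrict (cell s.1) := by
  rw [← restrict_biUnion_cell, ← hT]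
  refine Measure.restrict_congr_set (subset_closure.eventuallyLE.antisymm ?_)
  have hnull : volume (⋃ s ∈ T, frontier (cell s.1)) = 0 :=
    (measure_biUnion_null_iff (Finset.countable_toSet T)).2 fun s _ =>
      (convex_convexHull ℝ (s.1 : Set (E d))).addHaar_frontier volume
  filter_upwards [measure_eq_zero_iff_ae_notMem.1 hnull] with x hx hxU
  have hxU' : x ∈ closure U := hxU
  rw [hT] at hxU'
  obtain ⟨s, hs, hxs⟩ := Set.mem_iUnion₂.1 hxU'
  have hxi : x ∈ interior (cell s.1) := by
    by_contra hi
    exact hx (Set.mem_iUnion₂.2 ⟨s, hs, subset_closure hxs, hi⟩)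
  have hsub : cell s.1 ⊆ closure U := by
    rw [hT]
    exact Set.subset_biUnion_of_mem (u := fun s : P.elements => cell s.1) hs
  have : x ∈ U := by
    rw [← hU]
    exact interior_mono hsub hxi
  exact this

/-! ### Jets of finite-element functions as square-integrable functions -/

/-- The space of square-integrable jets on an element. -/
abbrev JetSpace (s : P.elements) : Type :=
  Lp (WithLp 2 (E d × ℝ)) 2 ((volume : Measure (E d)).restrict (cell s.1))

lemma _root_.Schwarz.l2Norm_eq_zero {F : Type*} [NormedAddCommGroup F] {K : Set (E d)}
    {f : E d → F} (hf : MemLp f 2 (volume.restrict K)) (h : l2Norm K f = 0) :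
    f =ᵐ[volume.restrict K] 0 := by
  rw [← norm_toLp_eq_l2Norm hf, norm_eq_zero] at h
  exact (hf.toLp_eq_toLp_iff MemLp.zero).1 h

/-- The jet of the finite-element function with given nodal values on an element. -/
def jetMap (hP : P.Admissible Ω ΓD r c) (s : P.elements) :
    (Fin P.n → ℝ) →ₗ[ℝ] JetSpace s where
  toFun W := ((hP.isPolyOn_fe s.2 W).memLp_jet P.k).toLp
  map_add' V W := by
    rw [← MemLp.toLp_add]
    refine MemLp.toLp_congr _ _ ?_
    filter_upwards [ae_mem_interior_cell s.1] with x hx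
    rw [Pi.add_apply, ← jet_add P.k ((hP.isPolyOn_fe s.2 V).differentiableAt hx)
      ((hP.isPolyOn_fe s.2 W).differentiableAt hx)]
    congr 1
    ext y
    simp [fe, add_mul, Finset.sum_add_distrib]
  map_smul' a W := by
    rw [RingHom.id_apply, ← MemLp.toLp_const_smul]
    refine MemLp.toLp_congr _ _ ?_
    filter_upwards [ae_mem_interior_cell s.1] with x hx
    rw [Pi.smul_apply, ← jet_const_mul P.k a ((hP.isPolyOn_fe s.2 W).differentiableAt hx)]
    congr 1
    ext y
    simp [fe, Finset.mul_sum, mul_assoc]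

/-- The jet of a finite-element function multiplied by a function that is affine on the element. -/
def mulJet (hP : P.Admissible Ω ΓD r c) (s : P.elements) {f : E d → ℝ}
    (hf : IsPolyOn 1 f (cell s.1)) (W : Fin P.n → ℝ) : JetSpace s :=
  (hf.memLp_smul_jet (hP.isPolyOn_fe s.2 W) P.k).toLp

namespace Admissible

variable (hP : P.Admissible Ω ΓD r c) (s : P.elements) {f : E d → ℝ}
  (hf : IsPolyOn 1 f (cell s.1))

lemma coeFn_jetMap (W : Fin P.n → ℝ) :
    jetMap hP s W =ᵐ[volume.restrict (cell s.1)] jet P.k (P.fe W) :=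
  MemLp.coeFn_toLp ((hP.isPolyOn_fe s.2 W).memLp_jet P.k)

lemma coeFn_mulJet (W : Fin P.n → ℝ) :
    mulJet hP s hf W =ᵐ[volume.restrict (cell s.1)] fun x => f x • jet P.k (P.fe W) x :=
  MemLp.coeFn_toLp _

lemma norm_jetMap (W : Fin P.n → ℝ) : ‖jetMap hP s W‖ = l2Norm (cell s.1) (jet P.k (P.fe W)) :=
  norm_toLp_eq_l2Norm ((hP.isPolyOn_fe s.2 W).memLp_jet P.k)

lemma norm_mulJet (W : Fin P.n → ℝ) :
    ‖mulJet hP s hf W‖ = l2Norm (cell s.1) (fun x => f x • jet P.k (P.fe W) x) :=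
  norm_toLp_eq_l2Norm _

lemma norm_jetMap_sub_mulJet (V W : Fin P.n → ℝ) :
    ‖jetMap hP s V - mulJet hP s hf W‖
      = l2Norm (cell s.1) (fun x => jet P.k (P.fe V) x - f x • jet P.k (P.fe W) x) := by
  have h1 : MemLp (jet P.k (P.fe V) - fun x => f x • jet P.k (P.fe W) x) 2
      (volume.restrict (cell s.1)) := ((hP.isPolyOn_fe s.2 V).memLp_jet P.k).sub
        (hf.memLp_smul_jet (hP.isPolyOn_fe s.2 W) P.k)
  have h2 : jetMap hP s V - mulJet hP s hf W = h1.toLp :=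
    (MemLp.toLp_sub ((hP.isPolyOn_fe s.2 V).memLp_jet P.k)
      (hf.memLp_smul_jet (hP.isPolyOn_fe s.2 W) P.k)).symm
  rw [h2, norm_toLp_eq_l2Norm h1]
  rfl

/-- Multiplication by a real function is self-adjoint in `L²`. -/
lemma inner_jetMap_mulJet (V W : Fin P.n → ℝ) :
    inner ℝ (jetMap hP s V) (mulJet hP s hf W) = inner ℝ (mulJet hP s hf V) (jetMap hP s W) := by
  rw [L2.inner_def, L2.inner_def]
  refine integral_congr_ae ?_
  filter_upwards [hP.coeFn_jetMap s V, hP.coeFn_jetMap s W, hP.coeFn_mulJet s hf V,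
    hP.coeFn_mulJet s hf W] with x h1 h2 h3 h4
  rw [h1, h2, h3, h4, real_inner_smul_left, real_inner_smul_right]

lemma norm_mulJet_le (h01 : ∀ x ∈ cell s.1, f x ∈ Set.Icc (0 : ℝ) 1) (W : Fin P.n → ℝ) :
    ‖mulJet hP s hf W‖ ≤ ‖jetMap hP s W‖ := by
  rw [norm_mulJet, norm_jetMap]
  refine l2Norm_mono ((hP.isPolyOn_fe s.2 W).memLp_jet P.k) ?_
  filter_upwards [ae_restrict_mem (isCompact_cell s.1).measurableSet] with x hx
  rw [norm_smul, Real.norm_of_nonneg (h01 x hx).1]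
  exact mul_le_of_le_one_left (norm_nonneg _) (h01 x hx).2

lemma mulJet_eq_zero (h0 : ∀ x ∈ cell s.1, f x = 0) (W : Fin P.n → ℝ) :
    mulJet hP s hf W = 0 := by
  rw [← norm_eq_zero, norm_mulJet]
  have : l2Norm (cell s.1) (fun x => f x • jet P.k (P.fe W) x)
      = l2Norm (cell s.1) (fun _ => (0 : ℝ)) := l2Norm_congr (by
    filter_upwards [ae_restrict_mem (isCompact_cell s.1).measurableSet] with x hx
    simp [h0 x hx])
  rw [this]
  simp [l2Norm]

lemma jetMap_congr {V W : Fin P.n → ℝ} (h : ∀ x ∈ cell s.1, P.fe V x = P.fe W x) :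
    jetMap hP s V = jetMap hP s W := by
  refine MemLp.toLp_congr ((hP.isPolyOn_fe s.2 V).memLp_jet P.k)
    ((hP.isPolyOn_fe s.2 W).memLp_jet P.k) ?_
  filter_upwards [ae_mem_interior_cell s.1] with x hx
  exact jet_congr P.k (eventuallyEq_of_mem_interior h hx)

lemma fe_eq_zero_of_jetMap (hd : 0 < d) {W : Fin P.n → ℝ} (h : jetMap hP s W = 0) :
    ∀ x ∈ cell s.1, P.fe W x = 0 := by
  refine hP.eq_zero_of_ae_cell hd s.2 (hP.isPolyOn_fe s.2 W).continuousOn ?_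
  have h1 := hP.coeFn_jetMap s W
  rw [h] at h1
  filter_upwards [h1, Lp.coeFn_zero (WithLp 2 (E d × ℝ)) 2 (volume.restrict (cell s.1))]
    with x hx hx0
  rw [hx0] at hx
  have h2 := norm_mul_le_norm_jet P.k (P.fe W) x
  rw [← hx] at h2
  have h3 : P.k * P.fe W x = 0 := norm_le_zero_iff.1 (h2.trans_eq (by simp))
  exact (mul_eq_zero.1 h3).resolve_left hP.k_pos.ne'

/-- Functions that are affine on an element, whose squares have sum at least `1 / Λ`. -/
lemma norm_sq_jetMap_le_sum {L : Type*} (S : Finset L) {g : L → E d → ℝ}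
    (hg : ∀ l, IsPolyOn 1 (g l) (cell s.1)) {Λ : ℝ}
    (hsum : ∀ x ∈ cell s.1, 1 ≤ Λ * ∑ l ∈ S, g l x ^ 2) (W : Fin P.n → ℝ) :
    ‖jetMap hP s W‖ ^ 2 ≤ Λ * ∑ l ∈ S, ‖mulJet hP s (hg l) W‖ ^ 2 := by
  have hi : ∀ l, Integrable (fun x => ‖g l x • jet P.k (P.fe W) x‖ ^ 2)
      (volume.restrict (cell s.1)) := fun l =>
    ((hg l).memLp_smul_jet (hP.isPolyOn_fe s.2 W) P.k).norm.integrable_sq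
  simp only [norm_jetMap, norm_mulJet, sq_l2Norm]
  rw [← integral_finsetSum _ fun l _ => hi l, ← integral_const_mul]
  refine integral_mono_of_nonneg (Eventually.of_forall fun _ => by positivity)
    ((integrable_finsetSum _ fun l _ => hi l).const_mul Λ) ?_
  filter_upwards [ae_restrict_mem (isCompact_cell s.1).measurableSet] with x hx
  have h1 := mul_le_mul_of_nonneg_right (hsum x hx) (sq_nonneg ‖jet P.k (P.fe W) x‖)
  simp only [norm_smul, mul_pow, Real.norm_eq_abs, sq_abs]
  rw [← Finset.sum_mul, ← mul_assoc]
  simpa using h1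

end Admissible

namespace Admissible

/-! ### Locality of the nodal basis and of the partition of unity -/

lemma isClosed_dirichlet (hP : P.Admissible Ω ΓD r c) : IsClosed ΓD := by
  obtain ⟨F, hF, rfl⟩ := hP.dirichlet
  exact (hP.finite_mesh.subset fun t ht => (hF ht).1).isClosed_biUnion
    fun t _ => (isCompact_cell t).isClosed

lemma node_injective (hP : P.Admissible Ω ΓD r c) : Function.Injective P.node := by
  intro p q h
  have h1 := hP.φ_node p q
  rw [← h, hP.φ_node p p] at h1
  by_contra hpq
  simp [hpq] at h1

/-- A nodal basis function vanishes on the elements that do not contain its node. -/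
lemma φ_eq_zero (hP : P.Admissible Ω ΓD r c) (hd : 0 < d) (s : P.elements) {q : Fin P.n}
    (hq : P.node q ∉ cell s.1) : ∀ x ∈ cell s.1, P.φ q x = 0 := by
  have hqD : P.node q ∉ ΓD := fun h => by
    have := (hP.φ_fe q).2.2 _ h
    rw [hP.φ_node] at this
    simp at this
  have hfin : (P.node '' {p | p ≠ q}).Finite := Set.toFinite _
  have hqn : P.node q ∉ P.node '' {p | p ≠ q} := by
    rintro ⟨p, hp, h⟩
    exact hp (hP.node_injective h)
  -- A Urysohn function that is 1 at the node and 0 on the cell, on `ΓD` and at all other nodes has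
  -- interpolant `φ_q`. As it vanishes on the cell, the interpolation estimate forces its
  -- interpolant to vanish there too.
  obtain ⟨v, hv0, hv1, -⟩ := exists_continuous_zero_one_of_isClosed
    (s := cell s.1 ∪ ΓD ∪ P.node '' {p | p ≠ q}) (t := {P.node q})
    (((isCompact_cell s.1).isClosed.union hP.isClosed_dirichlet).union hfin.isClosed)
    isClosed_singleton (by
      rw [Set.disjoint_singleton_right]
      rintro ((h | h) | h)
      exacts [hq h, hqD h, hqn h])
  have hvs : ∀ x ∈ cell s.1, v x = 0 := fun x hx => hv0 (Or.inl (Or.inl hx))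
  have hint : P.interp v = P.φ q := by
    ext x
    rw [interp, Finset.sum_eq_single q]
    · rw [hv1 rfl, Pi.one_apply, one_mul]
    · intro p _ hp
      rw [hv0 (Or.inr ⟨p, hp, rfl⟩), Pi.zero_apply, zero_mul]
    · simp
  have herr := hP.interp_error s.1 s.2 v (fun _ => 0) v.continuous.continuousOn
    (fun x hx => hv0 (Or.inl (Or.inr hx))) contDiff_const hvs
  have hz : l2Norm (cell s.1) (iteratedFDeriv ℝ r fun _ : E d => (0 : ℝ)) = 0 := by
    simp [l2Norm]
  rw [hz, mul_zero, hint] at herr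
  have h0 : l2Norm (cell s.1) (⇑v - P.φ q) = 0 := le_antisymm
    ((le_add_of_nonneg_right (mul_nonneg Metric.diam_nonneg (l2Norm_nonneg _ _))).trans herr)
    (l2Norm_nonneg _ _)
  have hpoly := (hP.φ_fe q).2.1 s.1 s.2
  have h1 : l2Norm (cell s.1) (P.φ q) = 0 := by
    rw [← h0]
    refine l2Norm_congr ?_
    filter_upwards [ae_restrict_mem (isCompact_cell s.1).measurableSet] with x hx
    simp [hvs x hx]
  exact hP.eq_zero_of_ae_cell hd s.2 hpoly.continuousOn (l2Norm_eq_zero hpoly.memLp h1)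

lemma jetMap_congr_of_node (hP : P.Admissible Ω ΓD r c) (hd : 0 < d) (s : P.elements)
    {V W : Fin P.n → ℝ} (h : ∀ p, P.node p ∈ cell s.1 → V p = W p) :
    jetMap hP s V = jetMap hP s W := by
  refine hP.jetMap_congr s fun x hx => Finset.sum_congr rfl fun p _ => ?_
  by_cases hp : P.node p ∈ cell s.1
  · rw [h p hp]
  · rw [hP.φ_eq_zero hd s hp x hx, mul_zero, mul_zero]

/-- The partition of unity function `χ_ℓ` vanishes on all elements outside the subdomain. -/
lemma χ_eq_zero (hP : P.Admissible Ω ΓD r c) (hd : 0 < d) (s : P.elements) (ℓ : Fin P.N)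
    (hs : ¬ cell s.1 ⊆ closure (P.sub ℓ)) : ∀ x ∈ cell s.1, P.χ ℓ x = 0 := by
  obtain ⟨T, hT, hcl⟩ := hP.sub_elements ℓ
  refine hP.eq_zero_of_ae_cell hd s.2 (hP.χ_linear ℓ s.1 s.2).continuousOn ?_
  -- The cell is none of those that make up the subdomain, so it meets the support of `χ_ℓ` in a
  -- null set.
  have hnull : volume (⋃ t ∈ T, cell s.1 ∩ cell t) = 0 := by
    refine (measure_biUnion_null_iff (hP.finite_elements.subset hT).countable).2 fun t ht => ?_
    refine volume_cell_inter_cell s.2 (hT ht) ?_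
    rintro rfl
    refine hs ?_
    rw [hcl]
    exact Set.subset_biUnion_of_mem (u := fun t => cell t) ht
  filter_upwards [ae_restrict_mem (isCompact_cell s.1).measurableSet,
    ae_restrict_of_ae (measure_eq_zero_iff_ae_notMem.1 hnull)] with x hx hx0
  by_contra hne
  have h1 := hP.χ_supp ℓ x (hP.cell_subset s.2 hx) hne
  rw [hcl] at h1
  obtain ⟨t, ht, hxt⟩ := Set.mem_iUnion₂.1 h1
  exact hx0 (Set.mem_iUnion₂.2 ⟨t, ht, hx, hxt⟩)

lemma closure_sub_eq_iUnion (hP : P.Admissible Ω ΓD r c) (ℓ : Fin P.N) :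
    closure (P.sub ℓ) = ⋃ s : P.elements, ⋃ _ : cell s.1 ⊆ closure (P.sub ℓ), cell s.1 := by
  refine Set.Subset.antisymm ?_ (Set.iUnion₂_subset fun s hs => hs)
  obtain ⟨T, hT, hcl⟩ := hP.sub_elements ℓ
  intro x hx
  rw [hcl] at hx
  obtain ⟨t, ht, hxt⟩ := Set.mem_iUnion₂.1 hx
  refine Set.mem_iUnion₂.2 ⟨⟨t, hT ht⟩, ?_, hxt⟩
  rw [hcl]
  exact Set.subset_biUnion_of_mem (u := fun t => cell t) ht

open Classical in
/-- An element is contained in at most `Λ` of the closed subdomains. -/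
lemma card_le_Λ (s : P.elements) :
    (Finset.univ.filter fun ℓ => cell s.1 ⊆ closure (P.sub ℓ)).card ≤ P.Λ := by
  rcases (Finset.univ.filter fun ℓ => cell s.1 ⊆ closure (P.sub ℓ)).eq_empty_or_nonempty
    with h | ⟨ℓ, hℓ⟩
  · simp [h]
  -- All closed subdomains containing the cell share its vertices, so they are counted among the
  -- neighbours of any one of them.
  · refine le_trans (Finset.card_le_card fun ℓ' hℓ' => ?_)
      (Finset.le_sup (f := fun ℓ : Fin P.N => (Finset.univ.filter fun ℓ' : Fin P.N =>
        (closure (P.sub ℓ) ∩ closure (P.sub ℓ')).Nonempty).card) (Finset.mem_univ ℓ))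
    rw [Finset.mem_filter] at hℓ hℓ' ⊢
    have hne : s.1.Nonempty := by
      rw [← Finset.card_pos, s.2.2]
      omega
    obtain ⟨x, hx⟩ := hne
    have hx' : x ∈ cell s.1 := subset_convexHull ℝ _ hx
    exact ⟨Finset.mem_univ _, x, hℓ.2 hx', hℓ'.2 hx'⟩

-- Cauchy–Schwarz for `1 = ∑ χ_ℓ`, a sum with at most `Λ` terms on the element.
open Classical in
lemma one_le_Λ_mul_sum_sq (hP : P.Admissible Ω ΓD r c) (hd : 0 < d) (s : P.elements) :
    ∀ x ∈ cell s.1, 1 ≤ (P.Λ : ℝ)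
      * ∑ ℓ ∈ Finset.univ.filter (fun ℓ => cell s.1 ⊆ closure (P.sub ℓ)), P.χ ℓ x ^ 2 := by
  intro x hx
  have h1 : ∑ ℓ ∈ Finset.univ.filter (fun ℓ => cell s.1 ⊆ closure (P.sub ℓ)), P.χ ℓ x = 1 := by
    rw [← hP.χ_sum x (hP.cell_subset s.2 hx)]
    refine Finset.sum_subset (Finset.filter_subset _ _) fun ℓ _ hℓ => ?_
    exact hP.χ_eq_zero hd s ℓ (fun h => hℓ (by simp [h])) x hx
  have h2 := sq_sum_le_card_mul_sum_sq (s := Finset.univ.filter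
    (fun ℓ => cell s.1 ⊆ closure (P.sub ℓ))) (f := fun ℓ => P.χ ℓ x)
  rw [h1, one_pow] at h2
  refine h2.trans (mul_le_mul_of_nonneg_right (by exact_mod_cast card_le_Λ s)
    (Finset.sum_nonneg fun _ _ => sq_nonneg _))

end Admissible


/-! ### The energy matrices -/

lemma integrableOn_inner_gradient {m m' : ℕ} {f g : E d → ℝ} {s : Finset (E d)}
    (hf : IsPolyOn m f (cell s)) (hg : IsPolyOn m' g (cell s)) :
    Integrable (fun x => inner ℝ (gradient f x) (gradient g x)) (volume.restrict (cell s)) := by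
  refine ((hf.memLp_gradient.norm.integrable_mul hg.memLp_gradient.norm)).mono'
    (hf.memLp_gradient.1.inner hg.memLp_gradient.1) (Eventually.of_forall fun x => ?_)
  exact norm_inner_le_norm _ _

namespace Admissible

lemma inner_jetMap_single (hP : P.Admissible Ω ΓD r c) (s : P.elements) (p q : Fin P.n) :
    inner ℝ (jetMap hP s (Pi.single p 1)) (jetMap hP s (Pi.single q 1))
      = (∫ x in cell s.1, inner ℝ (gradient (P.φ p) x) (gradient (P.φ q) x))
        + P.k ^ 2 * ∫ x in cell s.1, P.φ p x * P.φ q x := by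
  have hfe : ∀ p, P.fe (Pi.single p 1) = P.φ p := fun p => by
    ext x
    simp [fe, Pi.single_apply]
  have hpol := fun p => (hP.φ_fe p).2.1 s.1 s.2
  have hint : Integrable (fun x => P.φ p x * P.φ q x) (volume.restrict (cell s.1)) :=
    (hpol p).memLp.integrable_mul (hpol q).memLp
  rw [← integral_const_mul, ← integral_add (integrableOn_inner_gradient (hpol p) (hpol q))
    (hint.const_mul _), L2.inner_def]
  refine integral_congr_ae ?_
  filter_upwards [hP.coeFn_jetMap s (Pi.single p 1), hP.coeFn_jetMap s (Pi.single q 1)]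
    with x h1 h2
  rw [h1, h2, hfe, hfe, inner_jet]

lemma energy_apply (hP : P.Admissible Ω ΓD r c) {U : Set (E d)} {T : Finset P.elements}
    (hU : (volume : Measure (E d)).restrict U = ∑ s ∈ T, volume.restrict (cell s.1))
    (p q : Fin P.n) : P.energy U p q = ((∑ s ∈ T,
      inner ℝ (jetMap hP s (Pi.single p 1)) (jetMap hP s (Pi.single q 1)) : ℝ) : ℂ) := by
  have hpol := fun p (s : P.elements) => (hP.φ_fe p).2.1 s.1 s.2
  simp only [hP.inner_jetMap_single, Finset.sum_add_distrib, ← Finset.mul_sum]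
  simp only [energy, Matrix.add_apply, Matrix.smul_apply, Matrix.map_apply, stiffness, mass, hU]
  rw [integral_finsetSum_measure fun s _ => integrableOn_inner_gradient (hpol p s) (hpol q s),
    integral_finsetSum_measure (f := fun x => P.φ p x * P.φ q x)
      fun s _ => (hpol p s).memLp.integrable_mul (hpol q s).memLp]
  push_cast
  rfl

lemma inner_jetMap (hP : P.Admissible Ω ΓD r c) (s : P.elements) (V W : Fin P.n → ℝ) :
    inner ℝ (jetMap hP s V) (jetMap hP s W) = ∑ p, ∑ q, V p * W q *
      inner ℝ (jetMap hP s (Pi.single p 1)) (jetMap hP s (Pi.single q 1)) := by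
  have h : ∀ V, jetMap hP s V = ∑ p, V p • jetMap hP s (Pi.single p 1) := fun V => by
    conv_lhs => rw [pi_eq_sum_univ' V]
    simp only [map_sum, map_smul]
  rw [h V, h W]
  simp only [sum_inner, inner_sum, real_inner_smul_left, real_inner_smul_right]
  rw [Finset.sum_comm]
  exact Finset.sum_congr rfl fun p _ => Finset.sum_congr rfl fun q _ => by ring

end Admissible

/-! ### Splitting of the complex energy into real jets on elements -/

/-- Real (`true`) and imaginary (`false`) part. -/
def part : Bool → ℂ →ₗ[ℝ] ℝ
  | true => Complex.reLm
  | false => Complex.imLm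

/-- The jet on an element of the real or imaginary part of a finite-element function with complex
nodal values. -/
def partJet (hP : P.Admissible Ω ΓD r c) (a : P.elements × Bool) :
    (Fin P.n → ℂ) →ₗ[ℝ] JetSpace a.1 :=
  jetMap hP a.1 ∘ₗ (part a.2).compLeft (Fin P.n)

namespace Admissible

/-- The energy matrix is a real Gram matrix, so the real part of the form pairs real parts with real
parts and imaginary parts with imaginary parts. -/
lemma re_ip_energy (hP : P.Admissible Ω ΓD r c) {U : Set (E d)} {T : Finset P.elements}
    (hU : (volume : Measure (E d)).restrict U = ∑ s ∈ T, volume.restrict (cell s.1))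
    (V W : Fin P.n → ℂ) : (ip (P.energy U) V W).re
      = ∑ a ∈ T ×ˢ Finset.univ, inner ℝ (partJet hP a V) (partJet hP a W) := by
  obtain ⟨g, hg⟩ : ∃ g : P.elements → Fin P.n → Fin P.n → ℝ, ∀ s p q, g s p q
      = inner ℝ (jetMap hP s (Pi.single p 1)) (jetMap hP s (Pi.single q 1)) :=
    ⟨_, fun _ _ _ => rfl⟩
  have hsymm : ∀ s p q, g s p q = g s q p := fun s p q => by rw [hg, hg, real_inner_comm]
  have hjet : ∀ s V W, inner ℝ (jetMap hP s V) (jetMap hP s W)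
      = ∑ p, ∑ q, V p * W q * g s p q := fun s V W => by simp only [hg]; exact hP.inner_jetMap s V W
  have henergy : ∀ p q, P.energy U p q = ((∑ s ∈ T, g s p q : ℝ) : ℂ) := fun p q => by
    simp only [hg]; exact hP.energy_apply hU p q
  rw [Finset.sum_product]
  simp only [Fintype.sum_bool, partJet, LinearMap.comp_apply, hjet, ← Finset.sum_add_distrib]
  simp only [ip, dotProduct, Matrix.mulVec, Finset.mul_sum, Complex.re_sum, henergy,
    Complex.ofReal_sum, Finset.sum_mul]
  rw [Finset.sum_congr rfl fun p _ => Finset.sum_comm, Finset.sum_comm]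
  refine Finset.sum_congr rfl fun s _ => ?_
  rw [Finset.sum_comm]
  refine Finset.sum_congr rfl fun p _ => Finset.sum_congr rfl fun q _ => ?_
  rw [hsymm s q p]
  simp [part]
  ring

lemma sq_nrm_energy (hP : P.Admissible Ω ΓD r c) {U : Set (E d)} {T : Finset P.elements}
    (hU : (volume : Measure (E d)).restrict U = ∑ s ∈ T, volume.restrict (cell s.1))
    (V : Fin P.n → ℂ) : nrm (P.energy U) V ^ 2
      = ∑ a ∈ T ×ˢ Finset.univ, ‖partJet hP a V‖ ^ 2 := by
  have h := hP.re_ip_energy hU V V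
  simp only [real_inner_self_eq_norm_sq] at h
  rw [nrm, h, Real.sq_sqrt (Finset.sum_nonneg fun _ _ => by positivity)]

lemma eq_zero_of_partJet_eq_zero (hP : P.Admissible Ω ΓD r c) (hd : 0 < d) {V : Fin P.n → ℂ}
    (h : ∀ a, partJet hP a V = 0) : V = 0 := by
  have h1 : ∀ b p, part b (V p) = 0 := by
    intro b p
    have hp := hP.node_mem p
    rw [hP.closure_eq_iUnion] at hp
    obtain ⟨s, hs, hps⟩ := Set.mem_iUnion₂.1 hp
    have := hP.fe_eq_zero_of_jetMap ⟨s, hs⟩ hd (h (⟨s, hs⟩, b)) _ hps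
    rwa [hP.fe_node] at this
  ext p
  exact Complex.ext (h1 true p) (h1 false p)

end Admissible

/-! ### Restriction and extension of nodal vectors -/

open Classical in
/-- Extension by zero of nodal vectors on a subdomain. -/
def ext (P : Discretisation d) (ℓ : Fin P.N) (X : P.LocalNode ℓ → ℂ) (p : Fin P.n) : ℂ :=
  if h : P.node p ∈ closure (P.sub ℓ) then X ⟨p, h⟩ else 0

/-- Multiplication of the nodal values by those of the partition of unity function `χ_ℓ`. -/
def weight (P : Discretisation d) (ℓ : Fin P.N) (V : Fin P.n → ℂ) (p : Fin P.n) : ℂ :=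
  P.χ ℓ (P.node p) * V p

lemma ext_apply (ℓ : Fin P.N) (X : P.LocalNode ℓ → ℂ) (p : P.LocalNode ℓ) :
    P.ext ℓ X p.1 = X p := by
  simp [ext, p.2]

lemma ext_apply_of_notMem {ℓ : Fin P.N} (X : P.LocalNode ℓ → ℂ) {p : Fin P.n}
    (hp : P.node p ∉ closure (P.sub ℓ)) : P.ext ℓ X p = 0 := by
  simp [ext, hp]

lemma sum_localNode (ℓ : Fin P.N) (f : Fin P.n → ℂ)
    (hf : ∀ p, P.node p ∉ closure (P.sub ℓ) → f p = 0) :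
    ∑ p : P.LocalNode ℓ, f p.1 = ∑ p, f p :=
  Fintype.sum_of_injective Subtype.val Subtype.val_injective _ _
    (fun p hp => hf p fun h => hp ⟨⟨p, h⟩, rfl⟩) fun _ => rfl

lemma ip_Dloc (ℓ : Fin P.N) (X Y : P.LocalNode ℓ → ℂ) :
    ip (P.Dloc ℓ) X Y = ip (P.energy (P.sub ℓ)) (P.ext ℓ X) (P.ext ℓ Y) := by
  simp only [ip, dotProduct, Matrix.mulVec, Dloc, Matrix.submatrix_apply, Pi.star_apply]
  rw [← sum_localNode ℓ _ fun p hp => by rw [ext_apply_of_notMem Y hp, star_zero, zero_mul]]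
  refine Finset.sum_congr rfl fun p _ => ?_
  rw [ext_apply, ← sum_localNode ℓ _ fun q hq => by rw [ext_apply_of_notMem X hq, mul_zero]]
  simp only [ext_apply]

lemma nrm_Dloc (ℓ : Fin P.N) (X : P.LocalNode ℓ → ℂ) :
    nrm (P.Dloc ℓ) X = nrm (P.energy (P.sub ℓ)) (P.ext ℓ X) := by
  rw [nrm, nrm, ip_Dloc]

lemma ext_add (ℓ : Fin P.N) (X Y : P.LocalNode ℓ → ℂ) :
    P.ext ℓ (X + Y) = P.ext ℓ X + P.ext ℓ Y := by
  ext p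
  by_cases h : P.node p ∈ closure (P.sub ℓ) <;> simp [ext, h]

lemma R_transpose_mulVec (ℓ : Fin P.N) (X : P.LocalNode ℓ → ℂ) :
    (P.R ℓ).transpose.mulVec X = P.weight ℓ (P.ext ℓ X) := by
  ext q
  simp only [Matrix.mulVec, dotProduct, Matrix.transpose_apply, R, weight]
  have h := sum_localNode ℓ
    (fun p => (if p = q then (P.χ ℓ (P.node q) : ℂ) else 0) * P.ext ℓ X p)
    fun p hp => by rw [ext_apply_of_notMem X hp, mul_zero]
  simp only [ext_apply] at h
  rw [h]
  simp

/-- Nothing is lost by restricting, since `χ_ℓ` vanishes at the nodes off the closed subdomain. -/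
lemma Admissible.ext_R_mulVec (hP : P.Admissible Ω ΓD r c) (ℓ : Fin P.N) (V : Fin P.n → ℂ) :
    P.ext ℓ ((P.R ℓ).mulVec V) = P.weight ℓ V := by
  ext p
  by_cases h : P.node p ∈ closure (P.sub ℓ)
  · simp [ext, h, Matrix.mulVec, dotProduct, R, weight]
  · have h0 : P.χ ℓ (P.node p) = 0 := by
      by_contra hne
      exact h (hP.χ_supp ℓ _ (hP.node_mem p) hne)
    rw [ext_apply_of_notMem _ h, weight, h0]
    simp

/-- The defect of the local solution operator, extended by zero. -/
def defect (P : Discretisation d) (Ω ΓD : Set (E d)) (ℓ : Fin P.N) (V : Fin P.n → ℂ) :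
    Fin P.n → ℂ :=
  P.ext ℓ (((P.Aloc ΓD ℓ)⁻¹ * P.R ℓ * P.A Ω ΓD - P.R ℓ).mulVec V)

/-- Adding and subtracting `R_ℓ` is all that is needed, so the identity also holds with the value 0
that the inverse of a singular matrix takes. -/
lemma Admissible.Binv_mul_A_mulVec (hP : P.Admissible Ω ΓD r c) (V : Fin P.n → ℂ) :
    (P.Binv ΓD * P.A Ω ΓD).mulVec V
      = ∑ ℓ, P.weight ℓ (P.weight ℓ V + P.defect Ω ΓD ℓ V) := by
  rw [Binv, Finset.sum_mul, Matrix.sum_mulVec]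
  refine Finset.sum_congr rfl fun ℓ _ => ?_
  rw [defect, ← hP.ext_R_mulVec ℓ V, ← ext_add, ← R_transpose_mulVec, Matrix.mul_assoc,
    Matrix.mul_assoc, ← Matrix.mulVec_mulVec, Matrix.sub_mulVec]
  congr 1
  rw [add_sub_cancel, Matrix.mul_assoc]

lemma partJet_weight (hP : P.Admissible Ω ΓD r c) (a : P.elements × Bool) (ℓ : Fin P.N)
    (V : Fin P.n → ℂ) : partJet hP a (P.weight ℓ V)
      = jetMap hP a.1 fun p => P.χ ℓ (P.node p) * (part a.2).compLeft (Fin P.n) V p := by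
  rw [partJet, LinearMap.comp_apply]
  congr 1
  ext p
  rcases a with ⟨s, _ | _⟩ <;> simp [part, weight]

/-- The jet of `partJet` multiplied by the partition of unity function `χ_ℓ`. -/
def partMulJet (hP : P.Admissible Ω ΓD r c) (ℓ : Fin P.N) (a : P.elements × Bool)
    (V : Fin P.n → ℂ) : JetSpace a.1 :=
  mulJet hP a.1 (hP.χ_linear ℓ a.1.1 a.1.2) ((part a.2).compLeft (Fin P.n) V)

end Discretisation

lemma nrm_nonneg {I : Type*} [Fintype I] (D : Matrix I I ℂ) (V : I → ℂ) : 0 ≤ nrm D V :=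
  Real.sqrt_nonneg _

namespace Discretisation

variable {d : ℕ} {P : Discretisation d} {Ω ΓD : Set (E d)} {r : ℕ} {c : Constants}

/-! ### The preconditioned matrix -/

open Classical in
/-- The elements that make up the closure of a subdomain. -/
def subElements (P : Discretisation d) [Fintype P.elements] (ℓ : Fin P.N) : Finset P.elements :=
  Finset.univ.filter fun s => cell s.1 ⊆ closure (P.sub ℓ)

namespace Admissible

lemma δ_le (P : Discretisation d) (ℓ : Fin P.N) : P.δ ≤ P.δℓ ℓ :=
  ciInf_le (Set.finite_range _).bddBelow ℓ

lemma kδ_pos (hP : P.Admissible Ω ΓD r c) : 0 < P.k * P.δ := c.cδ_pos.trans_le hP.kδ_ge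

lemma δ_pos (hP : P.Admissible Ω ΓD r c) : 0 < P.δ :=
  pos_of_mul_pos_right hP.kδ_pos hP.k_pos.le

lemma norm_gradient_χ_le (hP : P.Admissible Ω ΓD r c) (ℓ : Fin P.N) (s : P.elements) :
    ∀ x ∈ interior (cell s.1), ‖gradient (P.χ ℓ) x‖ ≤ |c.Cχ| / P.δ := fun x hx =>
  calc ‖gradient (P.χ ℓ) x‖ ≤ c.Cχ / P.δℓ ℓ := hP.χ_grad ℓ s.1 s.2 x hx
    _ ≤ |c.Cχ| / P.δℓ ℓ := div_le_div_of_nonneg_right (le_abs_self _) (hP.δℓ_pos ℓ).le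
    _ ≤ |c.Cχ| / P.δ := div_le_div_of_nonneg_left (abs_nonneg _) hP.δ_pos (δ_le P ℓ)

lemma Λ_pos (hP : P.Admissible Ω ΓD r c) (hd : 0 < d) (hΩ : Ω.Nonempty) : 0 < (P.Λ : ℝ) := by
  obtain ⟨x, hx⟩ := hΩ
  have hx' := subset_closure hx
  rw [hP.closure_eq_iUnion] at hx'
  obtain ⟨s, hs, hxs⟩ := Set.mem_iUnion₂.1 hx'
  have h := hP.one_le_Λ_mul_sum_sq hd ⟨s, hs⟩ x hxs
  refine lt_of_le_of_ne (Nat.cast_nonneg _) fun h0 => ?_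
  rw [← h0, zero_mul] at h
  linarith

lemma restrict_domain (hP : P.Admissible Ω ΓD r c) [Fintype P.elements]
    (hΩ : interior (closure Ω) = Ω) :
    (volume : Measure (E d)).restrict Ω
      = ∑ s ∈ (Finset.univ : Finset P.elements), volume.restrict (cell s.1) := by
  refine restrict_eq_sum_cell hΩ ?_
  rw [hP.closure_eq_iUnion, Set.biUnion_eq_iUnion]
  simp

lemma restrict_sub (hP : P.Admissible Ω ΓD r c) [Fintype P.elements] (ℓ : Fin P.N) :
    (volume : Measure (E d)).restrict (P.sub ℓ)
      = ∑ s ∈ P.subElements ℓ, volume.restrict (cell s.1) := by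
  refine restrict_eq_sum_cell (hP.sub_regular ℓ) ?_
  simpa [subElements] using hP.closure_sub_eq_iUnion ℓ

/-- The local bound in terms of jets. Restricting `V` to the subdomain and extending by zero keeps
its nodal values on the subdomain's elements, hence its jets there. -/
lemma sum_norm_sq_defect_le (hP : P.Admissible Ω ΓD r c) [Fintype P.elements] (hd : 0 < d)
    {ℓ : Fin P.N} {σ : ℝ} (hσ : P.LocalBound Ω ΓD ℓ σ) (V : Fin P.n → ℂ) :
    ∑ a ∈ P.subElements ℓ ×ˢ Finset.univ, ‖partJet hP a (P.defect Ω ΓD ℓ V)‖ ^ 2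
      ≤ σ ^ 2 * ∑ a ∈ P.subElements ℓ ×ˢ Finset.univ, ‖partJet hP a V‖ ^ 2 := by
  have h1 := pow_le_pow_left₀ (nrm_nonneg _ _) (hσ V) 2
  rw [mul_pow, nrm_Dloc, nrm_Dloc, hP.sq_nrm_energy (hP.restrict_sub ℓ),
    hP.sq_nrm_energy (hP.restrict_sub ℓ)] at h1
  refine h1.trans_eq ?_
  congr 1
  refine Finset.sum_congr rfl fun a ha => ?_
  have hs : cell a.1.1 ⊆ closure (P.sub ℓ) := by
    simpa [subElements] using ha
  congr 2
  refine hP.jetMap_congr_of_node hd a.1 fun p hp => ?_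
  rw [LinearMap.compLeft_apply, LinearMap.compLeft_apply, Function.comp_apply,
    Function.comp_apply, ext_apply ℓ (fun q => V q.1) ⟨p, hs hp⟩]

end Admissible

/-- Bounds for the preconditioned matrix of a single problem. -/
theorem exists_preconditioned_bounds (d : ℕ) (hd : 0 < d) (r : ℕ) (hr : 1 ≤ r) (c : Constants) :
    ∃ K : ℝ, 0 ≤ K ∧ ∀ (Ω ΓD : Set (E d)) (P : Discretisation d) (σ : ℝ), Ω.Nonempty →
      interior (closure Ω) = Ω → P.Admissible Ω ΓD r c → 0 ≤ σ →
      (∀ ℓ, P.LocalBound Ω ΓD ℓ σ) → ∀ V : Fin P.n → ℂ,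
      nrm (P.D Ω) ((P.Binv ΓD * P.A Ω ΓD).mulVec V)
          ≤ (1 + K / (P.k * P.δ)) ^ 2 * (P.Λ * (1 + σ)) * nrm (P.D Ω) V ∧
      (1 / P.Λ - σ * P.Λ - P.Λ * (K / (P.k * P.δ)) * (2 + K / (P.k * P.δ) + σ))
          * nrm (P.D Ω) V ^ 2
        ≤ (ip (P.D Ω) V ((P.Binv ΓD * P.A Ω ΓD).mulVec V)).re ∧
      (V ≠ 0 → 0 < nrm (P.D Ω) V) := by
  classical
  obtain ⟨C, hC0, hC⟩ := exists_interp_mul_error d hd r hr c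
  refine ⟨C * |c.Cχ|, by positivity, fun Ω ΓD P σ hΩ hreg hP hσ hloc V => ?_⟩
  have : Fintype P.elements := hP.finite_elements.fintype
  set θ := C * |c.Cχ| / (P.k * P.δ) with hθdef
  have hθ : 0 ≤ θ := div_nonneg (by positivity) hP.kδ_pos.le
  have hΛ := hP.Λ_pos hd hΩ
  have hm : ∀ ℓ a V, ‖partMulJet hP ℓ a V‖ ≤ ‖partJet hP a V‖ := fun ℓ a V =>
    hP.norm_mulJet_le a.1 _ (fun x hx => hP.χ_mem ℓ x (hP.cell_subset a.1.2 hx)) _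
  -- The gradient bound `G` is kept free: `G = |Cχ| / δ` gives the commutator estimate, and `G = 0`
  -- shows that nodal multiplication by `χ_ℓ` annihilates the jet on elements outside the subdomain.
  have herr : ∀ (ℓ : Fin P.N) (a : P.elements × Bool) (G : ℝ), 0 ≤ G →
      (∀ x ∈ interior (cell a.1.1), ‖gradient (P.χ ℓ) x‖ ≤ G) → ∀ V,
      ‖partJet hP a (P.weight ℓ V) - partMulJet hP ℓ a V‖ ≤ C * (G / P.k) * ‖partJet hP a V‖ := by
    intro ℓ a G hG hGr V
    have h := hC Ω ΓD P hP a.1.1 a.1.2 (P.χ ℓ) G (hP.χ_cont ℓ) (hP.χ_linear ℓ a.1.1 a.1.2) hG hGr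
      ((part a.2).compLeft (Fin P.n) V)
    rwa [← hP.norm_jetMap a.1,
      ← hP.norm_jetMap_sub_mulJet a.1 (hP.χ_linear ℓ a.1.1 a.1.2), ← partJet_weight] at h
  have hQ : ∀ ℓ a V, a ∈ P.subElements ℓ ×ˢ (Finset.univ : Finset Bool) →
      ‖partJet hP a (P.weight ℓ V) - partMulJet hP ℓ a V‖ ≤ θ * ‖partJet hP a V‖ := by
    intro ℓ a V _
    have h := herr ℓ a _ (div_nonneg (abs_nonneg _) hP.δ_pos.le)
      (hP.norm_gradient_χ_le ℓ a.1) V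
    have e : C * (|c.Cχ| / P.δ / P.k) = θ := by
      rw [hθdef, div_div, mul_comm P.δ, mul_div_assoc]
    rwa [e] at h
  have hQ0 : ∀ ℓ a V, a ∉ P.subElements ℓ ×ˢ (Finset.univ : Finset Bool) →
      partJet hP a (P.weight ℓ V) = 0 := by
    intro ℓ a V ha
    have hs : ¬ cell a.1.1 ⊆ closure (P.sub ℓ) := by simpa [subElements] using ha
    have hz := hP.χ_eq_zero hd a.1 ℓ hs
    have h := herr ℓ a 0 le_rfl (fun x hx => by
      rw [gradient_congr (eventuallyEq_of_mem_interior hz hx)]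
      simp [gradient]) V
    rw [partMulJet, hP.mulJet_eq_zero a.1 _ hz, sub_zero] at h
    simpa using h
  have hfilter : ∀ a : P.elements × Bool, (Finset.univ.filter fun ℓ =>
      a ∈ P.subElements ℓ ×ˢ (Finset.univ : Finset Bool))
      = Finset.univ.filter fun ℓ => cell a.1.1 ⊆ closure (P.sub ℓ) := fun a => by
    ext ℓ
    simp [subElements]
  have hcard : ∀ a : P.elements × Bool, ((Finset.univ.filter fun ℓ =>
      a ∈ P.subElements ℓ ×ˢ (Finset.univ : Finset Bool)).card : ℝ) ≤ P.Λ := fun a => by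
    rw [hfilter]
    exact_mod_cast Admissible.card_le_Λ a.1
  have hE := fun ℓ V => hP.sum_norm_sq_defect_le hd (hloc ℓ) V
  have hsum : ∀ a V, ‖partJet hP a V‖ ^ 2 ≤ P.Λ * ∑ ℓ ∈ Finset.univ.filter (fun ℓ =>
      a ∈ P.subElements ℓ ×ˢ (Finset.univ : Finset Bool)), ‖partMulJet hP ℓ a V‖ ^ 2 := by
    intro a V
    rw [hfilter]
    exact hP.norm_sq_jetMap_le_sum a.1 _ (fun ℓ => hP.χ_linear ℓ a.1.1 a.1.2)
      (hP.one_le_Λ_mul_sum_sq hd a.1) _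
  have hnrm : ∀ V, nrm (P.D Ω) V ^ 2 = ∑ a, ‖partJet hP a V‖ ^ 2 := fun V => by
    rw [D, hP.sq_nrm_energy (hP.restrict_domain hreg)]
    rfl
  have hnn := nrm_nonneg (P.D Ω)
  refine ⟨?_, ?_, fun hV => ?_⟩
  · have h := schwarz_norm_le (j := partJet hP) (Q := P.weight) (Ev := P.defect Ω ΓD)
      (m := partMulJet hP) (T := fun ℓ => P.subElements ℓ ×ˢ Finset.univ) hθ hσ hΛ.le hm hQ hQ0 hcard hE V
    rw [← hP.Binv_mul_A_mulVec, ← hnrm, ← hnrm, ← mul_pow] at h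
    exact le_of_sq_le_sq h (mul_nonneg (by positivity) (hnn V))
  · have h := schwarz_inner_ge (j := partJet hP) (Q := P.weight) (Ev := P.defect Ω ΓD)
      (m := partMulJet hP) (T := fun ℓ => P.subElements ℓ ×ˢ Finset.univ) hθ hσ hΛ hm
      (fun ℓ a V W => hP.inner_jetMap_mulJet a.1 (hP.χ_linear ℓ a.1.1 a.1.2) _ _) hsum hQ hQ0
      hcard hE (fun ℓ V W => by ext p; simp [weight, mul_add]) V
    rw [← hP.Binv_mul_A_mulVec, ← hnrm] at h
    refine h.trans_eq ?_
    rw [D, hP.re_ip_energy (hP.restrict_domain hreg)]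
    rfl
  · refine lt_of_le_of_ne (hnn V) fun h0 => hV (hP.eq_zero_of_partJet_eq_zero hd fun a => ?_)
    have h := hnrm V
    rw [← h0, zero_pow two_ne_zero] at h
    have h1 := (Finset.sum_eq_zero_iff_of_nonneg fun a _ => by positivity).1 h.symm a
      (Finset.mem_univ a)
    exact norm_eq_zero.1 (pow_eq_zero_iff two_ne_zero |>.1 h1)

end Discretisation

end Schwarz

end

/-! ### Uniform constants for a family of problems -/

theorem theorem3p9 {d : ℕ} (hd : d = 2 ∨ d = 3) (Ω ΓD : Set (Schwarz.E d))
    (hΩ : IsOpen Ω) (hΩne : Ω.Nonempty) (hΩreg : interior (closure Ω) = Ω)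
    (hΓD : ΓD ⊆ frontier Ω) (hΓI : 0 < Schwarz.surface d (frontier Ω \ ΓD))
    (r : ℕ) (hr : 2 ≤ r) (c : Schwarz.Constants) :
    ∃ C : ℝ, 0 < C ∧
      ∀ (ι : Type) (P : ι → Schwarz.Discretisation d) (σ : ι → ℝ),
        (∀ i, (P i).Admissible Ω ΓD r c) →
        (∀ i, 0 < σ i) →
        (∀ i ℓ, (P i).LocalBound Ω ΓD ℓ (σ i)) →
        (∀ i, ∀ V : Fin (P i).n → ℂ,
          Schwarz.nrm ((P i).D Ω) (((P i).Binv ΓD * (P i).A Ω ΓD).mulVec V)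
            ≤ C * ((P i).Λ * (1 + σ i)) * Schwarz.nrm ((P i).D Ω) V) ∧
        (Tendsto (fun i => (P i).k * (P i).δ) (comap (fun i => (P i).k) atTop) atTop →
          ∀ᶠ i in comap (fun i => (P i).k) atTop,
            ∃ R : ℝ, |R| ≤ C * ((P i).Λ / ((P i).k * (P i).δ)) * (1 + σ i) ∧
              ∀ V : Fin (P i).n → ℂ, V ≠ 0 →
                (1 / (P i).Λ - √2 * σ i * (P i).Λ) + R
                  ≤ ‖Schwarz.ip ((P i).D Ω) V (((P i).Binv ΓD * (P i).A Ω ΓD).mulVec V)‖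
                    / Schwarz.nrm ((P i).D Ω) V ^ 2) := by
  obtain ⟨K, hK0, hK⟩ := Schwarz.Discretisation.exists_preconditioned_bounds d (by omega) r
    (by omega) c
  have hcδ := c.cδ_pos
  -- The first summand serves (i), the second (ii); both use `θ = K/(kδ) ≤ K/c_δ`.
  refine ⟨(1 + K / c.cδ) ^ 2 + K * (2 + K / c.cδ), by positivity, fun ι P σ hP hσ hloc => ?_⟩
  have hθle : ∀ i, K / ((P i).k * (P i).δ) ≤ K / c.cδ := fun i =>
    div_le_div_of_nonneg_left hK0 hcδ (hP i).kδ_ge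
  have hkδ := fun i => (hP i).kδ_pos
  refine ⟨fun i V => ?_, fun _ => Eventually.of_forall fun i => ?_⟩
  · have hσi := hσ i
    have hk := hkδ i
    refine ((hK Ω ΓD (P i) (σ i) hΩne hΩreg (hP i) (hσ i).le (hloc i) V).1).trans ?_
    refine mul_le_mul_of_nonneg_right ?_ (Real.sqrt_nonneg _)
    refine mul_le_mul_of_nonneg_right ?_ (by positivity)
    refine le_trans ?_ (le_add_of_nonneg_right (by positivity))
    have := hθle i
    gcongr
  · have hσi := hσ i
    have hk := hkδ i
    set q : ℝ := (P i).Λ / ((P i).k * (P i).δ) with hq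
    have hq0 : 0 ≤ q := by positivity
    -- Only a lower bound is required of `R`, so it is taken as the most negative value allowed.
    refine ⟨-(((1 + K / c.cδ) ^ 2 + K * (2 + K / c.cδ)) * q * (1 + σ i)), ?_, fun V hV => ?_⟩
    · rw [abs_neg, abs_of_nonneg (by positivity)]
    · obtain ⟨-, h2, h3⟩ := hK Ω ΓD (P i) (σ i) hΩne hΩreg (hP i) (hσ i).le (hloc i) V
      have hpos := h3 hV
      rw [le_div_iff₀ (by positivity)]
      -- The modulus of the form is at least its real part, for which the lower bound is known.
      refine le_trans (le_trans (mul_le_mul_of_nonneg_right ?_ (sq_nonneg _)) h2)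
        ((le_abs_self _).trans (Complex.abs_re_le_norm _))
      -- The real-part argument loses only `σΛ`, which is below `√2 σΛ`.
      have e1 : σ i * (P i).Λ ≤ √2 * σ i * (P i).Λ := by
        have : (1 : ℝ) ≤ √2 := Real.one_le_sqrt.2 (by norm_num)
        have h : 0 ≤ σ i * (P i).Λ := by positivity
        nlinarith
      have e2 : (P i).Λ * (K / ((P i).k * (P i).δ)) = K * q := by rw [hq]; ring
      have e3 : K * q * (2 + K / ((P i).k * (P i).δ) + σ i)
          ≤ ((1 + K / c.cδ) ^ 2 + K * (2 + K / c.cδ)) * q * (1 + σ i) := by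
        have e4 : 2 + K / ((P i).k * (P i).δ) + σ i ≤ (2 + K / c.cδ) * (1 + σ i) := by
          have h0 : 0 ≤ K / c.cδ * σ i := by positivity
          nlinarith [hθle i]
        calc _ ≤ K * q * ((2 + K / c.cδ) * (1 + σ i)) := by gcongr
          _ = K * (2 + K / c.cδ) * q * (1 + σ i) := by ring
          _ ≤ _ := by
            gcongr
            exact le_add_of_nonneg_left (by positivity)
      rw [e2]
      linarith
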